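/- **Setting.** Let $k$ be a nonzero commutative ring. Let $\mathcal C$ be the category whose objects are the finite sets and in which a morphism from $X$ to $Y$ is a correspondence, that is, a subset of $Y\times X$. The composite of $R\subseteq Z\times Y$ and $S\subseteq Y\times X$ is $RS=\{(z,x)\mid \exists y\in Y,\ (z,y)\in R,\ (y,x)\in S\}$. Write $\mathcal C(Y,X)$ for the set of correspondences from $X$ to $Y$, and let $k\mathcal C$ be the $k$-linearization of $\mathcal C$. A correspondence functor is a $k$-linear functor from $k\mathcal C$ to $k$-modules. Morphisms of correspondence functors are natural transformations, and subfunctors, quotients, kernels and surjectivity are understood pointwise. An order on a finite set is a partial order relation, where $(a,b)\in R$ means $a\le_R b$, and $R^{op}$ is the opposite order. *Fundamental functors.* Let $(E,R)$ be a finite poset. A relation on $E$ is inessential if it factors through a set with fewer than $|E|$ elements. Let $\mathcal P_E$ be the quotient of the algebra $k\mathcal C(E,E)$ by the two-sided ideal generated by all inessential relations and all differences $S-\overline S$, where $S$ is a reflexive relation on $E$ and $\overline S$ is its transitive closure. Let $f_R=\sum_{S\supseteq R}\mu(R,S)\,S\in\mathcal P_E$, where $S$ runs over the orders on $E$ containing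 $R$ and $\mu$ is the Möbius function of the set of orders on $E$, ordered by inclusion. The fundamental module $\mathcal P_Ef_R$ is the left ideal generated by $f_R$, seen as a $k\mathcal C(E,E)$-module $W$. Set $L_{E,W}(X)=k\mathcal C(X,E)\otimes_{k\mathcal C(E,E)}W$, and let $J_{E,W}(X)$ be the set of all $\sum_i\phi_i\otimes w_i\in L_{E,W}(X)$ such that $\sum_i(\psi\phi_i)\cdot w_i=0$ for all $\psi\in k\mathcal C(E,X)$. The fundamental functor of $(E,R)$ is $\mathbb S_{E,R}=L_{E,W}/J_{E,W}$ for $W=\mathcal P_Ef_R$. *Functors of lattices.* Let $T$ be a finite lattice with least element $\hat 0$. Let $F_T(X)$ be the free $k$-module on the set of all maps $X\to T$, on which a correspondence $S\subseteq Y\times X$ acts by $(S\varphi)(y)=\bigvee_{(y,x)\in S}\varphi(x)$, an empty join being $\hat 0$. Let $E$ be the set of (join-)irreducible elements of $T$ ($\hat 0$ is not irreducible), let $R$ be the restriction to $E$ of the order of $T$, and let $\iota:E\to T$ be the inclusion. Let $H_T$ be the subfunctor of $F_T$ such that $H_T(X)$ is spanned by all maps $\varphi:X\to T$ with $E\not\subseteq\varphi(X)$.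 **Theorem.** Let $T$ be a finite lattice and let $(E,R)$ be the full subposet of its irreducible elements. Let $(D,Q)$ be a finite poset such that there exists a surjective morphism of correspondence functors $\Phi:F_T/H_T\to\mathbb S_{D,Q}$. Then: 1. $|D|=|E|$. 2. The posets $(D,Q)$ and $(E,R^{op})$ are isomorphic. In particular, if $D=E$, there is a permutation $\sigma$ of $E$ such that $R^{op}=\{(\sigma(a),\sigma(b))\mid(a,b)\in Q\}$. 3. There is a unique morphism $\Theta_T:F_T\to\mathbb S_{E,R^{op}}$ sending $\iota\in F_T(E)$ to the class of $\Delta_E\otimes f_{R^{op}}$, where $\Delta_E$ is the identity relation on $E$. It induces a morphism $\overline\Theta_T:F_T/H_T\to\mathbb S_{E,R^{op}}$. The kernel of $\overline\Theta_T$ vanishes at $E$, and $$\overline\Theta_{T,E}:F_T(E)/H_T(E)\longrightarrow\mathbb S_{E,R^{op}}(E)$$ is an isomorphism. Moreover, $w\mapsto\Delta_E\otimes w$ induces an isomorphism $\mathcal P_Ef_{R^{op}}\cong\mathbb S_{E,R^{op}}(E)$ of $k\mathcal C(E,E)$-modules. -/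

import Mathlib

open CategoryTheory TensorProduct

universe u v w

/-! ### Finite sets and correspondences -/

/-- Finite sets, the objects of the category of correspondences. -/
structure FinCorr : Type (u + 1) where
  carrier : Type u
  [isFinite : Finite carrier]

namespace FinCorr

instance : CoeSort FinCorr.{u} (Type u) := ⟨carrier⟩

instance (X : FinCorr.{u}) : Finite X := X.isFinite

/-- A correspondence from `X` to `Y` is a subset of `Y × X`. -/
@[ext]
structure Hom (X Y : FinCorr.{u}) : Type u where
  rel : Set (Y × X)

/-- The composite of `S ⊆ Y × X` and `R ⊆ Z × Y`, in diagrammatic order `S ≫ R`, is the set of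
all `(z, x)` such that `(z, y) ∈ R` and `(y, x) ∈ S` for some `y`. -/
instance : Category FinCorr.{u} where
  Hom := Hom
  id X := ⟨{p | p.1 = p.2}⟩
  comp {X Y Z} S R := ⟨{p : Z × X | ∃ y : Y, (p.1, y) ∈ R.rel ∧ (y, p.2) ∈ S.rel}⟩
  id_comp S := by ext ⟨a, b⟩; simp
  comp_id S := by ext ⟨a, b⟩; simp
  assoc S R Q := by
    ext ⟨a, b⟩
    constructor
    · rintro ⟨y, h, z, h', h''⟩
      exact ⟨z, ⟨y, h, h'⟩, h''⟩
    · rintro ⟨z, ⟨y, h, h'⟩, h''⟩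
      exact ⟨y, h, z, h', h''⟩

end FinCorr

/-- An order on `X`: a partial order relation, seen as a subset of `X × X`, where `(a, b)` belongs
to the relation if and only if `a ≤ b`. -/
@[ext]
structure OrderOn (X : Type u) : Type u where
  rel : Set (X × X)
  refl : ∀ a, (a, a) ∈ rel
  antisymm : ∀ a b, (a, b) ∈ rel → (b, a) ∈ rel → a = b
  trans : ∀ a b c, (a, b) ∈ rel → (b, c) ∈ rel → (a, c) ∈ rel

namespace OrderOn

/-- The orders on `X` are ordered by inclusion of relations. -/
instance (X : Type u) : PartialOrder (OrderOn X) :=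
  PartialOrder.lift OrderOn.rel fun _ _ h => OrderOn.ext h

instance (X : Type u) [Finite X] : Finite (OrderOn X) :=
  Finite.of_injective OrderOn.rel fun _ _ h => OrderOn.ext h

noncomputable instance (X : Type u) [Finite X] : Fintype (OrderOn X) := Fintype.ofFinite _

open Classical in
noncomputable instance (X : Type u) [Finite X] : LocallyFiniteOrder (OrderOn X) :=
  Fintype.toLocallyFiniteOrder

/-- The opposite order. -/
def op {X : Type u} (R : OrderOn X) : OrderOn X where
  rel := {p | (p.2, p.1) ∈ R.rel}
  refl a := R.refl a
  antisymm a b h h' := R.antisymm a b h' h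
  trans a b c h h' := R.trans c b a h' h

/-- The order relation of a partially ordered type. -/
def ofLE (X : Type u) [PartialOrder X] : OrderOn X where
  rel := {p | p.1 ≤ p.2}
  refl a := le_refl a
  antisymm _ _ h h' := le_antisymm h h'
  trans _ _ _ h h' := le_trans h h'

end OrderOn

namespace FinCorr

/-- An order on a finite set, as a relation on that set. -/
def ofOrder {X : FinCorr.{u}} (R : OrderOn X) : X ⟶ X := ⟨R.rel⟩

/-- A relation on `X` is inessential if it factors through a set of cardinality strictly smaller
than that of `X`. -/
def Inessential {X : FinCorr.{u}} (S : X ⟶ X) : Prop :=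
  ∃ (Y : FinCorr.{u}) (V : X ⟶ Y) (U : Y ⟶ X), Nat.card Y < Nat.card X ∧ S = V ≫ U

/-- Reflexive relations. -/
def Reflexive {X : FinCorr.{u}} (S : X ⟶ X) : Prop := ∀ a : X, (a, a) ∈ S.rel

/-- The transitive closure of a relation. -/
def transClosure {X : FinCorr.{u}} (S : X ⟶ X) : X ⟶ X :=
  ⟨{p | Relation.TransGen (fun a b => (a, b) ∈ S.rel) p.1 p.2}⟩

end FinCorr

noncomputable section

/-! ### Correspondence functors -/

/-- The `k`-linearization of the category of finite sets and correspondences. -/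
abbrev LinCorr (k : Type v) [CommRing k] := Free k FinCorr.{u}

/-- A correspondence, as a basis element of the module of morphisms of the linearization. -/
def lin (k : Type v) [CommRing k] {X Y : FinCorr.{u}} (S : X ⟶ Y) :
    Free.of k X ⟶ Free.of k Y :=
  (Free.embedding k FinCorr.{u}).map S

lemma lin_id (k : Type v) [CommRing k] (X : FinCorr.{u}) : lin k (𝟙 X) = 𝟙 (Free.of k X) :=
  (Free.embedding k FinCorr.{u}).map_id X

lemma lin_comp (k : Type v) [CommRing k] {X Y Z : FinCorr.{u}} (S : X ⟶ Y) (R : Y ⟶ Z) :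
    lin k (S ≫ R) = lin k S ≫ lin k R :=
  (Free.embedding k FinCorr.{u}).map_comp S R

/-- The morphisms from `X` to `Y` of `LinCorr k` form the free `k`-module on the set of all
correspondences from `X` to `Y`. -/
def linEquiv (k : Type v) [CommRing k] (X Y : FinCorr.{u}) :
    (Free.of k X ⟶ Free.of k Y) ≃ₗ[k] ((X ⟶ Y) →₀ k) where
  toFun α := α
  invFun α := α
  map_add' _ _ := rfl
  map_smul' _ _ := rfl
  left_inv _ := rfl
  right_inv _ := rfl

lemma linEquiv_lin (k : Type v) [CommRing k] {X Y : FinCorr.{u}} (S : X ⟶ Y) :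
    linEquiv k X Y (lin k S) = Finsupp.single S 1 := rfl

lemma lin_hom_ext {k : Type v} [CommRing k] {X Y : FinCorr.{u}} {W : Type w} [AddCommMonoid W]
    [Module k W] {f g : (Free.of k X ⟶ Free.of k Y) →ₗ[k] W}
    (h : ∀ S : X ⟶ Y, f (lin k S) = g (lin k S)) : f = g := by
  have H : f ∘ₗ (linEquiv k X Y).symm.toLinearMap = g ∘ₗ (linEquiv k X Y).symm.toLinearMap :=
    Finsupp.lhom_ext' fun S => LinearMap.ext_ring (h S)
  ext α
  exact LinearMap.congr_fun H (linEquiv k X Y α)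

/-- The category of functors from `LinCorr k` to `k`-modules. A correspondence functor over `k` is
a `k`-linear such functor; for each functor constructed below, `k`-linearity is proved as instances
of `Functor.Additive` and `Functor.Linear k`. -/
abbrev CorrFunctor (k : Type v) [CommRing k] := LinCorr.{u} k ⥤ ModuleCat.{max u v} k

/-- A subfunctor of a correspondence functor. -/
structure SubCorrFunctor {k : Type v} [CommRing k] (M : CorrFunctor.{u} k) where
  obj : ∀ X : LinCorr.{u} k, Submodule k (M.obj X)
  map_le : ∀ {X Y : LinCorr.{u} k} (α : X ⟶ Y), obj X ≤ (obj Y).comap (M.map α).hom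

namespace SubCorrFunctor

variable {k : Type v} [CommRing k] {M : CorrFunctor.{u} k}

/-- The quotient of a correspondence functor by a subfunctor. -/
def quotient (N : SubCorrFunctor M) : CorrFunctor.{u} k where
  obj X := ModuleCat.of k (M.obj X ⧸ N.obj X)
  map {X Y} α := ModuleCat.ofHom ((N.obj X).mapQ (N.obj Y) (M.map α).hom (N.map_le α))
  map_id X := by
    ext x
    simp
  map_comp α β := by
    ext x
    simp

instance (N : SubCorrFunctor M) [M.Additive] : N.quotient.Additive where
  map_add := by
    intro X Y α β
    ext x
    obtain ⟨x, rfl⟩ := (N.obj X).mkQ_surjective x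
    change (N.obj Y).mkQ ((M.map (α + β)).hom x) =
      (N.obj Y).mkQ ((M.map α).hom x) + (N.obj Y).mkQ ((M.map β).hom x)
    rw [M.map_add, ModuleCat.hom_add, LinearMap.add_apply, map_add]

instance (N : SubCorrFunctor M) [M.Linear k] : N.quotient.Linear k where
  map_smul := by
    intro X Y α r
    ext x
    obtain ⟨x, rfl⟩ := (N.obj X).mkQ_surjective x
    change (N.obj Y).mkQ ((M.map (r • α)).hom x) = r • (N.obj Y).mkQ ((M.map α).hom x)
    rw [M.map_smul, ModuleCat.hom_smul, LinearMap.smul_apply, map_smul]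

/-- The projection of a correspondence functor onto a quotient. -/
def proj (N : SubCorrFunctor M) : M ⟶ N.quotient where
  app X := ModuleCat.ofHom (N.obj X).mkQ
  naturality X Y α := by
    rfl

/-- The kernel of a morphism of correspondence functors. -/
def ker {M' : CorrFunctor.{u} k} (f : M ⟶ M') : SubCorrFunctor M where
  obj X := LinearMap.ker (f.app X).hom
  map_le {X Y} α := by
    intro x hx
    have h := congrArg (fun g => ModuleCat.Hom.hom g x) (f.naturality α)
    simp only [ModuleCat.hom_comp, LinearMap.comp_apply] at h
    rw [LinearMap.mem_ker] at hx
    rw [Submodule.mem_comap, LinearMap.mem_ker, h, hx, map_zero]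

end SubCorrFunctor

/-! ### The functor of a finite lattice -/

section Lattice

variable (k : Type v) [CommRing k] (T : Type u) [Lattice T] [BoundedOrder T]

variable {T} in
/-- The action of a correspondence `S ⊆ Y × X` on a map `φ : X → T`: the value at `y` is the join of
all `φ x` with `(y, x) ∈ S`. -/
def corrAct {X Y : FinCorr.{u}} (S : X ⟶ Y) (φ : X → T) : Y → T :=
  fun y => (Set.toFinite {x : X | (y, x) ∈ S.rel}).toFinset.sup φ

variable {T} in
lemma corrAct_id {X : FinCorr.{u}} (φ : X → T) : corrAct (𝟙 X) φ = φ := by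
  funext y
  apply le_antisymm
  · refine Finset.sup_le fun x hx => ?_
    rw [Set.Finite.mem_toFinset] at hx
    rw [show y = x from hx]
  · refine Finset.le_sup (f := φ) ?_
    rw [Set.Finite.mem_toFinset]
    exact rfl

variable {T} in
lemma corrAct_comp {X Y Z : FinCorr.{u}} (S : X ⟶ Y) (R : Y ⟶ Z) (φ : X → T) :
    corrAct (S ≫ R) φ = corrAct R (corrAct S φ) := by
  funext z
  apply le_antisymm
  · refine Finset.sup_le fun x hx => ?_
    rw [Set.Finite.mem_toFinset] at hx
    obtain ⟨y, hy, hx⟩ := hx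
    refine le_trans (Finset.le_sup (f := φ) (b := x) ?_)
      (Finset.le_sup (f := corrAct S φ) (b := y) ?_)
    · rw [Set.Finite.mem_toFinset]
      exact hx
    · rw [Set.Finite.mem_toFinset]
      exact hy
  · refine Finset.sup_le fun y hy => Finset.sup_le fun x hx => ?_
    rw [Set.Finite.mem_toFinset] at hx hy
    refine Finset.le_sup (f := φ) ?_
    rw [Set.Finite.mem_toFinset]
    exact ⟨y, hy, hx⟩

/-- The action of `k`-linear combinations of correspondences on `k (T ^ X)`. -/
def latticeMap (X Y : FinCorr.{u}) :
    (Free.of k X ⟶ Free.of k Y) →ₗ[k] ((X → T) →₀ k) →ₗ[k] ((Y → T) →₀ k) :=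
  Finsupp.lift _ k (X ⟶ Y) (fun S => Finsupp.lmapDomain k k (corrAct S)) ∘ₗ
    (linEquiv k X Y).toLinearMap

lemma latticeMap_lin {X Y : FinCorr.{u}} (S : X ⟶ Y) :
    latticeMap k T X Y (lin k S) = Finsupp.lmapDomain k k (corrAct S) := by
  rw [latticeMap, LinearMap.comp_apply, LinearEquiv.coe_coe, linEquiv_lin]
  simp

lemma latticeMap_comp {X Y Z : FinCorr.{u}} (α : Free.of k X ⟶ Free.of k Y)
    (β : Free.of k Y ⟶ Free.of k Z) :
    latticeMap k T X Z (α ≫ β) = latticeMap k T Y Z β ∘ₗ latticeMap k T X Y α := by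
  have H : (Linear.comp (S := k) (Free.of k X) (Free.of k Y) (Free.of k Z)).compr₂ (latticeMap k T X Z) =
      ((LinearMap.llcomp k ((X → T) →₀ k) ((Y → T) →₀ k) ((Z → T) →₀ k) ∘ₗ
        latticeMap k T Y Z).flip ∘ₗ latticeMap k T X Y) := by
    refine lin_hom_ext (k := k) (X := X) (Y := Y)
      (W := (Free.of k Y ⟶ Free.of k Z) →ₗ[k] ((X → T) →₀ k) →ₗ[k] ((Z → T) →₀ k)) fun S => ?_
    refine lin_hom_ext (k := k) (X := Y) (Y := Z) (W := ((X → T) →₀ k) →ₗ[k] ((Z → T) →₀ k))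
      fun R => ?_
    change latticeMap k T X Z (lin k S ≫ lin k R) =
      latticeMap k T Y Z (lin k R) ∘ₗ latticeMap k T X Y (lin k S)
    rw [← lin_comp, latticeMap_lin, latticeMap_lin, latticeMap_lin]
    ext φ : 2
    simp [corrAct_comp]
  exact LinearMap.congr_fun (LinearMap.congr_fun H α) β

/-- The correspondence functor `F_T` of the finite lattice `T`: its value at `X` is the free
`k`-module on the set of all maps `X → T`. -/
def latticeFunctor : CorrFunctor.{u} k where
  obj X := ModuleCat.of k ((X.carrier → T) →₀ k)
  map {X Y} α := ModuleCat.ofHom (latticeMap k T X Y α)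
  map_id X := by
    have h (X : FinCorr.{u}) : latticeMap k T X X (𝟙 (Free.of k X)) = LinearMap.id := by
      rw [← lin_id, latticeMap_lin]
      ext φ : 2
      simp [corrAct_id]
    exact congrArg ModuleCat.ofHom (h X)
  map_comp {X Y Z} α β := congrArg ModuleCat.ofHom (latticeMap_comp k T α β)

instance : (latticeFunctor k T).Additive where
  map_add {X Y α β} := congrArg ModuleCat.ofHom (map_add (latticeMap k T X Y) α β)

instance : (latticeFunctor k T).Linear k where
  map_smul {X Y} α r := congrArg ModuleCat.ofHom (map_smul (latticeMap k T X Y) r α)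

/-- The finite set of (join-)irreducible elements of the finite lattice `T`. -/
def irr [Finite T] : FinCorr.{u} := ⟨{e : T // SupIrred e}⟩

/-- The order of `T`, restricted to the set of irreducible elements. -/
def irrOrder [Finite T] : OrderOn (irr T) := OrderOn.ofLE {e : T // SupIrred e}

/-- The inclusion map of the set of irreducible elements in `T`, as an element of the value of
`latticeFunctor k T` at this set. -/
def irrIncl [Finite T] : (latticeFunctor k T).obj (Free.of k (irr T)) :=
  Finsupp.single (fun e : {e : T // SupIrred e} => (e : T)) (1 : k)

/-- The submodule of `k (T ^ X)` generated by all maps `φ : X → T` whose image does not contain all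
irreducible elements of `T`. -/
def nonFullSubmodule (X : FinCorr.{u}) : Submodule k ((X → T) →₀ k) :=
  Submodule.span k
    {m | ∃ φ : X → T, ¬ {e : T | SupIrred e} ⊆ Set.range φ ∧ m = Finsupp.single φ 1}

lemma nonFullSubmodule_le {X Y : FinCorr.{u}} (α : Free.of k X ⟶ Free.of k Y) :
    nonFullSubmodule k T X ≤ (nonFullSubmodule k T Y).comap (latticeMap k T X Y α) := by
  refine Submodule.span_le.2 ?_
  rintro _ ⟨φ, hφ, rfl⟩
  have H : (nonFullSubmodule k T Y).mkQ ∘ₗ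
      (latticeMap k T X Y).flip (Finsupp.single φ 1) = 0 := by
    refine lin_hom_ext fun S => ?_
    rw [LinearMap.comp_apply, LinearMap.flip_apply, latticeMap_lin, LinearMap.zero_apply,
      Submodule.mkQ_apply, Submodule.Quotient.mk_eq_zero, Finsupp.lmapDomain_apply,
      Finsupp.mapDomain_single]
    refine Submodule.subset_span ⟨_, fun h => hφ fun e he => ?_, rfl⟩
    obtain ⟨y, hy⟩ := h he
    obtain ⟨x, -, hx⟩ := SupIrred.finset_sup_eq he hy
    exact ⟨x, hx⟩
  have h := LinearMap.congr_fun H α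
  rwa [LinearMap.comp_apply, LinearMap.zero_apply, Submodule.mkQ_apply,
    Submodule.Quotient.mk_eq_zero] at h

/-- The subfunctor `H_T` of `F_T`. -/
def nonFull : SubCorrFunctor (latticeFunctor k T) where
  obj X := nonFullSubmodule k T X
  map_le α := nonFullSubmodule_le k T α

end Lattice

/-! ### The functors `L_{E,W}` and `J_{E,W}` -/

section Induction

variable {k : Type v} [CommRing k] (E : LinCorr.{u} k) (W : Type (max u v)) [AddCommGroup W]
  [Module k W]

/-- Left multiplication by `α` on the tensor product over `k`, before passing to the quotient. -/
def balancedMap (X Y : LinCorr.{u} k) :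
    (X ⟶ Y) →ₗ[k]
      ((E ⟶ X) ⊗[k] W) →ₗ[k] ((E ⟶ Y) ⊗[k] W) :=
  LinearMap.rTensorHom W ∘ₗ (Linear.comp E (X) (Y)).flip

lemma balancedMap_tmul {X Y : LinCorr.{u} k} (α : X ⟶ Y)
    (φ : E ⟶ X) (w : W) :
    balancedMap E W X Y α (φ ⊗ₜ[k] w) = (φ ≫ α) ⊗ₜ[k] w := rfl

variable [Module (End E) W]

/-- The relations defining the tensor product, over the (noncommutative) algebra of relations on
`E`, of the module of morphisms from `E` to `X` with `W`, as a quotient of the tensor product over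
`k`. The composite `a ≫ φ` is the product `φ a` in the notation for left actions. -/
def balancing (X : LinCorr.{u} k) : Submodule k ((E ⟶ X) ⊗[k] W) :=
  Submodule.span k {t | ∃ (φ : E ⟶ X) (a : End E) (w : W),
    t = ((a ≫ φ : E ⟶ X) ⊗ₜ[k] w) - φ ⊗ₜ[k] (a • w)}

lemma balancing_le {X Y : LinCorr.{u} k} (α : X ⟶ Y) :
    balancing E W X ≤ (balancing E W Y).comap (balancedMap E W X Y α) := by
  refine Submodule.span_le.2 ?_
  rintro _ ⟨φ, a, w, rfl⟩
  refine Submodule.subset_span ⟨φ ≫ α, a, w, ?_⟩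
  rw [map_sub, balancedMap_tmul, balancedMap_tmul, Category.assoc]

/-- The functor `X ↦ k𝒞(X, E) ⊗ W`, the tensor product being over `k𝒞(E, E)`. -/
def indFunctor : CorrFunctor.{u} k where
  obj X := ModuleCat.of k (((E ⟶ X) ⊗[k] W) ⧸ balancing E W X)
  map {X Y} α := ModuleCat.ofHom
    ((balancing E W X).mapQ (balancing E W Y) (balancedMap E W X Y α)
      (balancing_le E W α))
  map_id X := by
    refine ModuleCat.hom_ext (Submodule.linearMap_qext _ (TensorProduct.ext' fun φ w => ?_))
    change (balancing E W X).mkQ ((φ ≫ 𝟙 X) ⊗ₜ[k] w) =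
      (balancing E W X).mkQ (φ ⊗ₜ[k] w)
    rw [Category.comp_id]
  map_comp {X Y Z} α β := by
    refine ModuleCat.hom_ext (Submodule.linearMap_qext _ (TensorProduct.ext' fun φ w => ?_))
    change (balancing E W Z).mkQ ((φ ≫ α ≫ β) ⊗ₜ[k] w) =
      (balancing E W Z).mkQ (((φ ≫ α) ≫ β) ⊗ₜ[k] w)
    rw [Category.assoc]

instance : (indFunctor E W).Additive where
  map_add {X Y α β} := by
    refine ModuleCat.hom_ext (Submodule.linearMap_qext _ (TensorProduct.ext' fun φ w => ?_))
    change (balancing E W Y).mkQ ((φ ≫ (α + β)) ⊗ₜ[k] w) =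
      (balancing E W Y).mkQ ((φ ≫ α) ⊗ₜ[k] w) +
        (balancing E W Y).mkQ ((φ ≫ β) ⊗ₜ[k] w)
    rw [Preadditive.comp_add, TensorProduct.add_tmul, map_add]

instance : (indFunctor E W).Linear k where
  map_smul {X Y} α r := by
    refine ModuleCat.hom_ext (Submodule.linearMap_qext _ (TensorProduct.ext' fun φ w => ?_))
    change (balancing E W Y).mkQ ((φ ≫ (r • α)) ⊗ₜ[k] w) =
      r • (balancing E W Y).mkQ ((φ ≫ α) ⊗ₜ[k] w)
    rw [Linear.comp_smul, ← map_smul, TensorProduct.smul_tmul']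

/-- The bilinear map sending `(φ, w)` to the class of the tensor `φ ⊗ w`. -/
def indMk (X : LinCorr.{u} k) :
    (E ⟶ X) →ₗ[k] W →ₗ[k] (indFunctor E W).obj X :=
  (TensorProduct.mk k (E ⟶ X) W).compr₂ (balancing E W X).mkQ

variable [IsScalarTower k (End E) W]

/-- The map sending `φ ⊗ w` to `(ψ φ) • w`, where `ψ φ` is the composite `φ ≫ ψ`. -/
def indEval (X : LinCorr.{u} k) (ψ : X ⟶ E) :
    (indFunctor E W).obj X →ₗ[k] W :=
  (balancing E W X).liftQ
    (TensorProduct.lift ((Algebra.lsmul k k W : (End E) →ₐ[k] _).toLinearMap ∘ₗ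
      Linear.rightComp k E ψ)) <| by
    refine Submodule.span_le.2 ?_
    rintro _ ⟨φ, a, w, rfl⟩
    rw [SetLike.mem_coe, LinearMap.mem_ker, map_sub, sub_eq_zero]
    change End.of ((a ≫ φ) ≫ ψ) • w = End.of (φ ≫ ψ) • a • w
    rw [smul_smul, End.mul_def, Category.assoc]

lemma indEval_indMk {X : LinCorr.{u} k} (ψ : X ⟶ E)
    (φ : E ⟶ X) (w : W) :
    indEval E W X ψ (indMk E W X φ w) = End.of (φ ≫ ψ) • w := rfl

lemma indEval_map {X Y : LinCorr.{u} k} (α : X ⟶ Y)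
    (ψ : Y ⟶ E) :
    indEval E W Y ψ ∘ₗ ((indFunctor E W).map α).hom = indEval E W X (α ≫ ψ) := by
  refine Submodule.linearMap_qext _ (TensorProduct.ext' fun φ w => ?_)
  change End.of ((φ ≫ α) ≫ ψ) • w = End.of (φ ≫ α ≫ ψ) • w
  rw [Category.assoc]

/-- The subfunctor `J` of `indFunctor E W`: it consists at `X` of all elements `∑ φᵢ ⊗ wᵢ` such that
`∑ (ψ φᵢ) • wᵢ = 0` for all `ψ` from `X` to `E`. -/
def indRadical : SubCorrFunctor (indFunctor E W) where
  obj X := ⨅ ψ : X ⟶ E, LinearMap.ker (indEval E W X ψ)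
  map_le {X Y} α := by
    intro x hx
    rw [Submodule.mem_comap, Submodule.mem_iInf]
    intro ψ
    have h := LinearMap.congr_fun (indEval_map E W α ψ) x
    rw [LinearMap.comp_apply] at h
    rw [LinearMap.mem_ker, h]
    exact (Submodule.mem_iInf _).1 hx (α ≫ ψ)

end Induction

/-! ### Fundamental modules and fundamental functors -/

section Fundamental

variable (k : Type v) [CommRing k] {E : FinCorr.{u}}

variable (E) in
/-- The defining relations of the algebra of permuted orders on `E`, as a quotient of the algebra
of relations on `E`: inessential relations are zero and every reflexive relation is equal to its
transitive closure. -/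
inductive PermutedOrderRel : End (Free.of k E) → End (Free.of k E) → Prop
  | inessential (S : E ⟶ E) : FinCorr.Inessential S → PermutedOrderRel (lin k S) 0
  | reflexive (S : E ⟶ E) : FinCorr.Reflexive S →
      PermutedOrderRel (lin k S) (lin k (FinCorr.transClosure S))

variable (E) in
/-- The algebra of permuted orders on `E`. Its `k`-basis consists of the classes of the relations
`Δ_σ R`, where `σ` is a permutation of `E` and `R` is an order on `E`. The product of two orders
`R` and `S` is the transitive closure of `R ∪ S` if this is an order, and zero otherwise. -/
abbrev PermutedOrders := RingQuot (PermutedOrderRel k E)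

variable (E) in
/-- The projection of the algebra of relations on `E` onto the algebra of permuted orders. -/
def toPermutedOrders : End (Free.of k E) →ₐ[k] PermutedOrders k E :=
  RingQuot.mkAlgHom k (PermutedOrderRel k E)

open Classical in
/-- The idempotent `f_R` of the algebra of permuted orders: the sum over all orders `S` containing
`R` of `μ(R, S) S`, where `μ` is the Möbius function of the set of orders on `E`, ordered by
inclusion. -/
def fundIdempotent (R : OrderOn E) : PermutedOrders k E :=
  ∑ S : OrderOn E with R ≤ S,
    IncidenceAlgebra.mu k R S • toPermutedOrders k E (lin k (FinCorr.ofOrder S))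

/-- The fundamental module: the left ideal generated by `f_R` in the algebra of permuted orders. -/
def FundModule (R : OrderOn E) : Type (max u v) :=
  ↥(Ideal.span {fundIdempotent k R} : Ideal (PermutedOrders k E))

instance (R : OrderOn E) : AddCommGroup (FundModule k R) :=
  inferInstanceAs (AddCommGroup ↥(Ideal.span {fundIdempotent k R} : Ideal (PermutedOrders k E)))

instance (R : OrderOn E) : Module (PermutedOrders k E) (FundModule k R) :=
  inferInstanceAs (Module (PermutedOrders k E)
    ↥(Ideal.span {fundIdempotent k R} : Ideal (PermutedOrders k E)))

instance (R : OrderOn E) : Module k (FundModule k R) :=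
  inferInstanceAs (Module k ↥(Ideal.span {fundIdempotent k R} : Ideal (PermutedOrders k E)))

instance (R : OrderOn E) : IsScalarTower k (PermutedOrders k E) (FundModule k R) :=
  inferInstanceAs (IsScalarTower k (PermutedOrders k E)
    ↥(Ideal.span {fundIdempotent k R} : Ideal (PermutedOrders k E)))

/-- The fundamental module is a module over the algebra of relations on `E`, via the projection of
this algebra onto the algebra of permuted orders. -/
instance (R : OrderOn E) : Module (End (Free.of k E)) (FundModule k R) :=
  Module.compHom _ (toPermutedOrders k E).toRingHom

instance (R : OrderOn E) : IsScalarTower k (End (Free.of k E)) (FundModule k R) where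
  smul_assoc r a m := by
    change toPermutedOrders k E (r • a) • m = r • (toPermutedOrders k E a • m)
    rw [map_smul, smul_assoc]

/-- The element `f_R` of the fundamental module. -/
def fundGen (R : OrderOn E) : FundModule k R :=
  ⟨fundIdempotent k R, Ideal.subset_span rfl⟩

/-- The fundamental functor `𝕊_{E,R}`. -/
abbrev fundFunctor (R : OrderOn E) : CorrFunctor.{u} k :=
  (indRadical (Free.of k E) (FundModule k R)).quotient

instance (R : OrderOn E) : (fundFunctor k R).Additive := inferInstance

instance (R : OrderOn E) : (fundFunctor k R).Linear k := inferInstance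

/-- The canonical map from the fundamental module to the value at `E` of the fundamental functor,
sending `w` to the class of `Δ_E ⊗ w`. -/
def fundUnit (R : OrderOn E) : FundModule k R →ₗ[k] (fundFunctor k R).obj (Free.of k E) :=
  ((indRadical (Free.of k E) (FundModule k R)).proj.app (Free.of k E)).hom ∘ₗ
    indMk (Free.of k E) (FundModule k R) (Free.of k E) (𝟙 (Free.of k E))

end Fundamental

end

/-!
A relation `V` on `D` acts on `f_Q` in a simple way. If `V` contains the graph of a permutation `τ`
and is contained in its composite with `Q`, then `V f_Q = τ f_Q`; if there is no such `τ`, then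
`V f_Q = 0`. Indeed a relation containing the graph of no permutation is inessential by Hall's
marriage theorem, and the remaining relations reduce to reflexive ones, which are treated by
Möbius inversion.

As a consequence, sending a map `φ : X → T` to the class of `{(x, e) | e ≤ φ x} ⊗ f_{R^op}` is
compatible with the action of relations and kills `H_T`: this is `Θ_T`. Since the inclusion `ι`
generates `F_T`, the morphism `Θ_T` is unique.

The quotient `F_T / H_T` vanishes at all sets smaller than `E`, its value at `E` is a module over
the algebra of permuted orders, and `f_{R^op}` fixes the class of `ι`. Hence an element of
`F_T(E) / H_T(E)` killed by the morphism induced by `Θ_T` is zero. It also follows that a nonzero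
morphism to `𝕊_{D,Q}` first forces `|D| = |E|`, and then, after identifying `D` with `E`, the
existence of `b` with `f_{R^op} b f_Q ≠ 0`, which is only possible if `R^op` is conjugate to `Q`.
-/

theorem eq_of_le_of_injective_of_range_subset {ι α : Type*} [Finite ι] [PartialOrder α]
    {f g : ι → α} (hle : f ≤ g) (hg : Function.Injective g)
    (hrange : Set.range g ⊆ Set.range f) : f = g := by
  by_contra hne
  obtain ⟨i, hi, hmax⟩ := (Set.toFinite {i | f i ≠ g i}).exists_maximalFor g _
    (Function.ne_iff.1 hne)
  obtain ⟨i', hi'⟩ : g i ∈ Set.range f := hrange ⟨i, rfl⟩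
  have hii' : g i ≤ g i' := hi' ▸ hle i'
  have hg_eq : g i = g i' := by
    by_cases h : f i' = g i'
    · exact hi'.symm.trans h
    · exact le_antisymm hii' (hmax h hii')
  obtain rfl : i = i' := hg hg_eq
  exact hi hi'

section Moebius

variable {𝕜 α M : Type*} [Ring 𝕜] [PartialOrder α] [Fintype α] [LocallyFiniteOrder α]
  [AddCommGroup M] [Module 𝕜 M]

open IncidenceAlgebra

open Classical in
theorem sum_mu_smul_ite_le (a c : α) (x : M) :
    ∑ b : α with a ≤ b, mu 𝕜 a b • (if b ≤ c then x else 0) = if a = c then x else 0 := by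
  have hIcc : Finset.univ.filter (fun b => a ≤ b ∧ b ≤ c) = Finset.Icc a c := by
    ext b
    simp
  simp only [smul_ite, smul_zero]
  rw [← Finset.sum_filter, Finset.filter_filter, hIcc, ← Finset.sum_smul, sum_Icc_mu_right,
    ite_smul, one_smul, zero_smul]

open Classical in
theorem sum_mu_smul_sum_le (g : α → M) (a : α) :
    ∑ b : α with a ≤ b, mu 𝕜 a b • ∑ c : α with b ≤ c, g c = g a := by
  simp only [Finset.sum_filter (fun c => _ ≤ c), Finset.smul_sum]
  rw [← Finset.sum_filter, Finset.sum_comm]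
  simp only [sum_mu_smul_ite_le, Finset.sum_ite_eq, Finset.mem_univ, if_true]

open Classical in
theorem sum_sum_mu_smul (g : α → M) (a : α) :
    ∑ b : α with a ≤ b, ∑ c : α with b ≤ c, mu 𝕜 b c • g c = g a := by
  have hIcc (c : α) : Finset.univ.filter (fun b => a ≤ b ∧ b ≤ c) = Finset.Icc a c := by
    ext b
    simp
  have hsum (c : α) : ∑ b : α with a ≤ b, (if b ≤ c then mu 𝕜 b c • g c else 0) =
      if a = c then g c else 0 := by
    rw [← Finset.sum_filter, Finset.filter_filter, hIcc, ← Finset.sum_smul, sum_Icc_mu_left,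
      ite_smul, one_smul, zero_smul]
  simp only [Finset.sum_filter (fun c => _ ≤ c)]
  rw [← Finset.sum_filter, Finset.sum_comm]
  simp only [hsum, Finset.sum_ite_eq, Finset.mem_univ, if_true]

end Moebius

namespace FinCorr

variable {X Y Z : FinCorr.{u}}

theorem hom_ext {V U : X ⟶ Y} (h : ∀ y x, (y, x) ∈ V.rel ↔ (y, x) ∈ U.rel) : V = U :=
  Hom.ext (Set.ext fun p => h p.1 p.2)

/-- The graph of a map `f : X → Y`, as a correspondence from `X` to `Y`. It stands for the relation
`Δ_f` when `f` is a permutation. -/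
def graph (f : X → Y) : X ⟶ Y := ⟨{p | p.1 = f p.2}⟩

theorem mem_graph_comp (f : X → Y) (V : Y ⟶ Z) {z : Z} {x : X} :
    (z, x) ∈ (graph f ≫ V).rel ↔ (z, f x) ∈ V.rel :=
  ⟨fun ⟨_, hz, hy⟩ => Set.mem_of_eq_of_mem (congrArg _ hy.symm) hz, fun h => ⟨f x, h, rfl⟩⟩

theorem mem_comp_graph (V : X ⟶ Y) (e : Y ≃ Z) {z : Z} {x : X} :
    (z, x) ∈ (V ≫ graph e).rel ↔ (e.symm z, x) ∈ V.rel :=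
  ⟨fun ⟨_, hy, hx⟩ => Set.mem_of_eq_of_mem (congrArg (·, x) (e.symm_apply_eq.2 hy)) hx,
    fun h => ⟨e.symm z, (e.apply_symm_apply z).symm, h⟩⟩

theorem comp_graph_symm_comp_graph (V : X ⟶ Y) (e : Z ≃ Y) :
    (V ≫ graph e.symm) ≫ graph e = V :=
  hom_ext fun y x => by rw [mem_comp_graph, mem_comp_graph, e.symm_symm, e.apply_symm_apply]

/-- Elements of `s` are routed through the elements of `Y` related to them, all the others through
themselves. -/
theorem exists_factorization_through_image (V : X ⟶ Y) (s : Set X) :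
    ∃ (Z : FinCorr.{u}) (S : X ⟶ Z) (R : Z ⟶ Y),
      Nat.card Z = {y : Y | ∃ x ∈ s, (y, x) ∈ V.rel}.ncard + sᶜ.ncard ∧ V = S ≫ R := by
  refine ⟨⟨{y : Y | ∃ x ∈ s, (y, x) ∈ V.rel} ⊕ (sᶜ : Set X)⟩,
    ⟨{p | Sum.elim (fun y => p.2 ∈ s ∧ (y.1, p.2) ∈ V.rel) (fun x => x.1 = p.2) p.1}⟩,
    ⟨{p | Sum.elim (fun y => p.1 = y.1) (fun x => (p.1, x.1) ∈ V.rel) p.2}⟩,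
    Nat.card_sum, hom_ext fun y x => ⟨fun hV => ?_, ?_⟩⟩
  · by_cases hx : x ∈ s
    · exact ⟨Sum.inl ⟨y, x, hx, hV⟩, rfl, hx, hV⟩
    · exact ⟨Sum.inr ⟨x, hx⟩, hV, rfl⟩
  · rintro ⟨y' | x', hy, hx⟩
    · obtain rfl : y = y'.1 := hy
      exact hx.2
    · obtain rfl : x'.1 = x := hx
      exact hy

theorem exists_injective_or_factorization (V : X ⟶ Y) :
    (∃ f : X → Y, Function.Injective f ∧ ∀ x, (f x, x) ∈ V.rel) ∨
      ∃ (Z : FinCorr.{u}) (S : X ⟶ Z) (R : Z ⟶ Y), Nat.card Z < Nat.card X ∧ V = S ≫ R := by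
  classical
  have := Fintype.ofFinite Y
  rw [← Fintype.all_card_le_filter_rel_iff_exists_injective fun x y => (y, x) ∈ V.rel,
    or_iff_not_imp_left]
  intro hHall
  push Not at hHall
  obtain ⟨s, hs⟩ := hHall
  obtain ⟨Z, S, R, hcard, hV⟩ := exists_factorization_through_image V s
  refine ⟨Z, S, R, ?_, hV⟩
  have himage : {y : Y | ∃ x ∈ (s : Set X), (y, x) ∈ V.rel}.ncard < (s : Set X).ncard := by
    rw [Set.ncard_coe_finset]
    rw [← Set.ncard_coe_finset] at hs
    simpa using hs
  have := Set.ncard_add_ncard_compl (s : Set X)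
  omega

theorem inessential_of_forall_perm {V : X ⟶ X}
    (h : ∀ τ : Equiv.Perm X, ∃ x, (τ x, x) ∉ V.rel) : Inessential V := by
  refine (exists_injective_or_factorization V).resolve_left fun ⟨f, hf, hV⟩ => ?_
  obtain ⟨x, hx⟩ := h (Equiv.ofBijective f (Finite.injective_iff_bijective.1 hf))
  exact hx (hV x)

theorem Reflexive.inessential {V : X ⟶ X} (hrefl : Reflexive V)
    (htrans : ∀ a b c, (a, b) ∈ V.rel → (b, c) ∈ V.rel → (a, c) ∈ V.rel) {x y : X} (hxy : x ≠ y)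
    (h : (x, y) ∈ V.rel) (h' : (y, x) ∈ V.rel) : Inessential V := by
  refine ⟨⟨{z : X // z ≠ y}⟩, ⟨{p | (p.1.1, p.2) ∈ V.rel}⟩, ⟨{p | (p.1, p.2.1) ∈ V.rel}⟩,
    Finite.card_subtype_lt (x := y) (by simp), hom_ext fun a b => ⟨fun hab => ?_, ?_⟩⟩
  · by_cases hb : b = y
    · subst hb
      exact ⟨⟨x, hxy⟩, htrans _ _ _ hab h', h⟩
    · exact ⟨⟨b, hb⟩, hab, hrefl b⟩
  · rintro ⟨z, hz, hzb⟩
    exact htrans _ _ _ hz hzb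

theorem subset_transClosure (V : X ⟶ X) : V.rel ⊆ (transClosure V).rel :=
  fun _ hp => Relation.TransGen.single hp

theorem Reflexive.transClosure {V : X ⟶ X} (h : Reflexive V) : Reflexive (transClosure V) :=
  fun a => subset_transClosure V (h a)

theorem transClosure_subset_iff {V : X ⟶ X} {P : Set (X × X)}
    (htrans : ∀ a b c, (a, b) ∈ P → (b, c) ∈ P → (a, c) ∈ P) :
    (transClosure V).rel ⊆ P ↔ V.rel ⊆ P := by
  refine ⟨(subset_transClosure V).trans, fun hV => ?_⟩
  rintro ⟨a, b⟩ (hab : Relation.TransGen _ a b)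
  induction hab with
  | single h => exact hV h
  | tail _ h ih => exact htrans _ _ _ ih (hV h)

/-- The correspondence `V` lies between the graph of `τ` and its composite with the order `Q`.
Such a `V` acts on `f_Q` as the permutation `τ` does. -/
structure Fits (Q : OrderOn X) (V : X ⟶ X) (τ : Equiv.Perm X) : Prop where
  graph_mem : ∀ x, (τ x, x) ∈ V.rel
  mem_order : ∀ x y, (τ x, y) ∈ V.rel → (x, y) ∈ Q.rel

end FinCorr

/-- The order on `X` obtained from an order on `Y` by restriction along an injective map. -/
def OrderOn.comap {X Y : Type u} (Q : OrderOn Y) (f : X ↪ Y) : OrderOn X where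
  rel := {p | (f p.1, f p.2) ∈ Q.rel}
  refl _ := Q.refl _
  antisymm _ _ h h' := f.injective (Q.antisymm _ _ h h')
  trans _ _ _ h h' := Q.trans _ _ _ h h'

noncomputable section

section PermutedOrders

open FinCorr

variable (k : Type v) [CommRing k] {D : FinCorr.{u}}

/-- The class of a relation in the algebra of permuted orders. -/
def relClass (V : D ⟶ D) : PermutedOrders k D := toPermutedOrders k D (lin k V)

theorem relClass_mul (V U : D ⟶ D) : relClass k V * relClass k U = relClass k (U ≫ V) := by
  rw [relClass, relClass, relClass, ← map_mul, End.mul_def, lin_comp]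

variable {k} in
theorem permutedOrders_hom_ext {W : Type w} [AddCommMonoid W] [Module k W]
    {f g : PermutedOrders k D →ₗ[k] W} (h : ∀ V, f (relClass k V) = g (relClass k V)) :
    f = g := by
  have hlin : f ∘ₗ (toPermutedOrders k D).toLinearMap = g ∘ₗ (toPermutedOrders k D).toLinearMap :=
    lin_hom_ext h
  exact (LinearMap.cancel_right (RingQuot.mkAlgHom_surjective k _)).1 hlin

theorem relClass_eq_zero_of_inessential {V : D ⟶ D} (h : Inessential V) : relClass k V = 0 :=
  (RingQuot.mkAlgHom_rel k (PermutedOrderRel.inessential (k := k) V h)).trans (map_zero _)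

theorem relClass_transClosure {V : D ⟶ D} (h : Reflexive V) :
    relClass k V = relClass k (transClosure V) :=
  RingQuot.mkAlgHom_rel k (PermutedOrderRel.reflexive (k := k) V h)

open Classical in
theorem relClass_ofOrder (R : OrderOn D) :
    relClass k (ofOrder R) = ∑ S : OrderOn D with R ≤ S, fundIdempotent k S :=
  (sum_sum_mu_smul (𝕜 := k) (fun S => relClass k (ofOrder S)) R).symm

open Classical in
theorem relClass_of_reflexive {V : D ⟶ D} (h : Reflexive V) :
    relClass k V = ∑ S : OrderOn D with V.rel ⊆ S.rel, fundIdempotent k S := by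
  have hle (S : OrderOn D) : (transClosure V).rel ⊆ S.rel ↔ V.rel ⊆ S.rel :=
    transClosure_subset_iff S.trans
  have htrans : ∀ a b c, (a, b) ∈ (transClosure V).rel → (b, c) ∈ (transClosure V).rel →
      (a, c) ∈ (transClosure V).rel := fun _ _ _ => Relation.TransGen.trans
  rw [relClass_transClosure k h]
  by_cases hanti : ∀ a b, (a, b) ∈ (transClosure V).rel → (b, a) ∈ (transClosure V).rel → a = b
  · let C : OrderOn D := ⟨(transClosure V).rel, h.transClosure, hanti, htrans⟩
    refine (relClass_ofOrder k C).trans ?_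
    exact Finset.sum_congr (Finset.filter_congr fun S _ => hle S) fun _ _ => rfl
  · push Not at hanti
    obtain ⟨a, b, hab, hba, hne⟩ := hanti
    rw [relClass_eq_zero_of_inessential k (h.transClosure.inessential htrans hne hab hba),
      Finset.filter_false_of_mem, Finset.sum_empty]
    exact fun S _ hS => hne (S.antisymm _ _ ((hle S).2 hS hab) ((hle S).2 hS hba))

open Classical in
theorem relClass_mul_relClass_ofOrder {V : D ⟶ D} (h : Reflexive V) (R : OrderOn D) :
    relClass k V * relClass k (ofOrder R) =
      ∑ S : OrderOn D with R ≤ S, if V.rel ⊆ S.rel then fundIdempotent k S else 0 := by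
  have hsubset (S : OrderOn D) :
      (ofOrder R ≫ V).rel ⊆ S.rel ↔ R ≤ S ∧ V.rel ⊆ S.rel := by
    constructor
    · exact fun hS => ⟨fun p hp => hS ⟨p.1, h _, hp⟩, fun p hp => hS ⟨p.2, hp, R.refl _⟩⟩
    · rintro ⟨hRS, hVS⟩ ⟨a, b⟩ ⟨c, hac, hcb⟩
      exact S.trans _ _ _ (hVS hac) (hRS hcb)
  have hrefl : Reflexive (ofOrder R ≫ V) := fun a => ⟨a, h a, R.refl a⟩
  rw [relClass_mul, relClass_of_reflexive k hrefl, ← Finset.sum_filter, Finset.filter_filter]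
  exact Finset.sum_congr (Finset.filter_congr fun S _ => hsubset S) fun _ _ => rfl

open Classical in
theorem relClass_mul_fundIdempotent {V : D ⟶ D} (h : Reflexive V) (Q : OrderOn D) :
    relClass k V * fundIdempotent k Q = if V.rel ⊆ Q.rel then fundIdempotent k Q else 0 := by
  have hexpand : relClass k V * fundIdempotent k Q =
      ∑ R : OrderOn D with Q ≤ R,
        IncidenceAlgebra.mu k Q R • (relClass k V * relClass k (ofOrder R)) := by
    simp only [fundIdempotent, Finset.mul_sum, mul_smul_comm]
    rfl
  simp only [hexpand, relClass_mul_relClass_ofOrder k h, sum_mu_smul_sum_le]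

open Classical in
theorem relClass_mul_fundIdempotent_of_graph_mem {V : D ⟶ D} {τ : Equiv.Perm D}
    (h : ∀ x, (τ x, x) ∈ V.rel) (Q : OrderOn D) :
    relClass k V * fundIdempotent k Q =
      if ∀ x y, (τ x, y) ∈ V.rel → (x, y) ∈ Q.rel then
        relClass k (graph τ) * fundIdempotent k Q else 0 := by
  have hmem (x y : D) : (x, y) ∈ (V ≫ graph τ.symm).rel ↔ (τ x, y) ∈ V.rel :=
    mem_comp_graph V τ.symm
  have hrefl : Reflexive (V ≫ graph τ.symm) := fun x => (hmem x x).2 (h x)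
  conv_lhs => rw [← comp_graph_symm_comp_graph V τ, ← relClass_mul, mul_assoc,
    relClass_mul_fundIdempotent k hrefl, mul_ite, mul_zero]
  simp only [Set.subset_def, Prod.forall, hmem]

variable {k} in
theorem exists_fits_of_mul_ne_zero {Q : OrderOn D} {V : D ⟶ D}
    (h : relClass k V * fundIdempotent k Q ≠ 0) : ∃ τ, Fits Q V τ := by
  classical
  by_cases hperm : ∃ τ : Equiv.Perm D, ∀ x, (τ x, x) ∈ V.rel
  · obtain ⟨τ, hτ⟩ := hperm
    rw [relClass_mul_fundIdempotent_of_graph_mem k hτ] at h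
    exact ⟨τ, hτ, (ite_ne_right_iff.1 h).1⟩
  · push Not at hperm
    rw [relClass_eq_zero_of_inessential k (inessential_of_forall_perm hperm), zero_mul] at h
    exact absurd rfl h

theorem FinCorr.Fits.relClass_mul_fundIdempotent {Q : OrderOn D} {V : D ⟶ D} {τ : Equiv.Perm D}
    (h : Fits Q V τ) :
    relClass k V * fundIdempotent k Q = relClass k (graph τ) * fundIdempotent k Q := by
  classical
  rw [relClass_mul_fundIdempotent_of_graph_mem k h.graph_mem, if_pos h.mem_order]

theorem relClass_mul_fundIdempotent_congr {Q : OrderOn D} {U V : D ⟶ D}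
    (h : ∀ τ, Fits Q U τ ↔ Fits Q V τ) :
    relClass k U * fundIdempotent k Q = relClass k V * fundIdempotent k Q := by
  by_cases hU : ∃ τ, Fits Q U τ
  · obtain ⟨τ, hτ⟩ := hU
    rw [hτ.relClass_mul_fundIdempotent k, ((h τ).1 hτ).relClass_mul_fundIdempotent k]
  · have hV : ¬ ∃ τ, Fits Q V τ := fun ⟨τ, hτ⟩ => hU ⟨τ, (h τ).2 hτ⟩
    rw [not_imp_comm.1 exists_fits_of_mul_ne_zero hU,
      not_imp_comm.1 exists_fits_of_mul_ne_zero hV]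

open Classical in
theorem fundIdempotent_mul_graph_mul_fundIdempotent (R Q : OrderOn D) (τ : Equiv.Perm D) :
    fundIdempotent k R * (relClass k (graph τ) * fundIdempotent k Q) =
      if R = Q.comap τ.symm.toEmbedding then relClass k (graph τ) * fundIdempotent k Q else 0 := by
  have hle (S : OrderOn D) : (∀ x y, (τ x, y) ∈ (graph τ ≫ ofOrder S).rel → (x, y) ∈ Q.rel) ↔
      S ≤ Q.comap τ.symm.toEmbedding := by
    simp only [mem_graph_comp]
    refine ⟨fun h p hp => h _ _ ?_, fun h x y hxy => ?_⟩
    · exact Set.mem_of_eq_of_mem (by simp) hp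
    · exact Set.mem_of_eq_of_mem (by simp) (h hxy)
  have hact (S : OrderOn D) :
      relClass k (ofOrder S) * (relClass k (graph τ) * fundIdempotent k Q) =
        if S ≤ Q.comap τ.symm.toEmbedding then relClass k (graph τ) * fundIdempotent k Q
        else 0 := by
    rw [← mul_assoc, relClass_mul, relClass_mul_fundIdempotent_of_graph_mem k (τ := τ)
      fun x => (mem_graph_comp τ _).2 (S.refl _)]
    exact if_congr (hle S) rfl rfl
  have hexpand (x : PermutedOrders k D) : fundIdempotent k R * x =
      ∑ S : OrderOn D with R ≤ S, IncidenceAlgebra.mu k R S • (relClass k (ofOrder S) * x) := by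
    simp only [fundIdempotent, Finset.sum_mul, smul_mul_assoc]
    rfl
  simp only [hexpand, hact, sum_mu_smul_ite_le]

variable {k} in
theorem exists_eq_comap_of_mul_ne_zero {R Q : OrderOn D} {b : PermutedOrders k D}
    (h : fundIdempotent k R * (b * fundIdempotent k Q) ≠ 0) :
    ∃ τ : Equiv.Perm D, R = Q.comap τ.toEmbedding := by
  classical
  by_contra! hne
  have hzero : LinearMap.mulLeft k (fundIdempotent k R) ∘ₗ
      LinearMap.mulRight k (fundIdempotent k Q) = 0 := by
    refine permutedOrders_hom_ext fun V => ?_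
    change fundIdempotent k R * (relClass k V * fundIdempotent k Q) = 0
    by_contra hV
    obtain ⟨τ, hτ⟩ := exists_fits_of_mul_ne_zero (right_ne_zero_of_mul hV)
    rw [hτ.relClass_mul_fundIdempotent k, fundIdempotent_mul_graph_mul_fundIdempotent] at hV
    exact hne τ.symm (ite_ne_right_iff.1 hV).1
  exact h (LinearMap.congr_fun hzero b)

theorem toPermutedOrders_comp_eq_zero {X : FinCorr.{u}} (hX : Nat.card X < Nat.card D)
    (α : Free.of k D ⟶ Free.of k X) (β : Free.of k X ⟶ Free.of k D) :
    toPermutedOrders k D (α ≫ β) = 0 := by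
  have hlin : (Linear.comp (S := k) (Free.of k D) (Free.of k X) (Free.of k D)).compr₂
      (toPermutedOrders k D).toLinearMap = 0 := by
    refine lin_hom_ext (k := k) (X := D) (Y := X)
      (W := (Free.of k X ⟶ Free.of k D) →ₗ[k] PermutedOrders k D) fun V => ?_
    refine lin_hom_ext (k := k) (X := X) (Y := D) (W := PermutedOrders k D) fun U => ?_
    change toPermutedOrders k D (lin k V ≫ lin k U) = 0
    rw [← lin_comp]
    exact relClass_eq_zero_of_inessential k ⟨X, V, U, hX, rfl⟩
  exact LinearMap.congr_fun (LinearMap.congr_fun hlin α) β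

end PermutedOrders

section Generator

variable {k : Type v} [Ring k] {C : Type*} [Category C]

theorem app_map_apply {M N : C ⥤ ModuleCat.{w} k} (f : M ⟶ N) {X Y : C} (a : X ⟶ Y)
    (x : M.obj X) : (f.app Y).hom ((M.map a).hom x) = (N.map a).hom ((f.app X).hom x) :=
  NatTrans.naturality_apply f a x

theorem map_map_apply (M : C ⥤ ModuleCat.{w} k) {X Y Z : C} (a : X ⟶ Y) (b : Y ⟶ Z)
    (x : M.obj X) : (M.map b).hom ((M.map a).hom x) = (M.map (a ≫ b)).hom x :=
  (ConcreteCategory.congr_hom (M.map_comp a b) x).symm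

/-- The element `x` generates the functor `M`: every element of a value of `M` is the image of `x`
under some morphism. For linear functors this is generation in the usual sense, because the
images of `x` then form a submodule. -/
def IsGenerator (M : C ⥤ ModuleCat.{w} k) {X : C} (x : M.obj X) : Prop :=
  ∀ Y : C, Function.Surjective fun a : X ⟶ Y => (M.map a).hom x

namespace IsGenerator

variable {M N : C ⥤ ModuleCat.{w} k} {X : C} {x : M.obj X}

theorem hom_ext (hx : IsGenerator M x) {f g : M ⟶ N}
    (h : (f.app X).hom x = (g.app X).hom x) : f = g := by
  ext Y y
  obtain ⟨a, rfl⟩ := hx Y y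
  exact (app_map_apply f a x).trans ((congrArg _ h).trans (app_map_apply g a x).symm)

theorem app_ne_zero (hx : IsGenerator M x) {f : M ⟶ N} (hf : f ≠ 0) : (f.app X).hom x ≠ 0 :=
  fun h => hf (hx.hom_ext h)

theorem app_of_surjective (hx : IsGenerator M x) {f : M ⟶ N}
    (hf : ∀ Y, Function.Surjective (f.app Y).hom) : IsGenerator N ((f.app X).hom x) := by
  intro Y y
  obtain ⟨z, rfl⟩ := hf Y y
  obtain ⟨a, rfl⟩ := hx Y z
  exact ⟨a, (app_map_apply f a x).symm⟩

end IsGenerator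

end Generator

section LinearFunctor

variable {k : Type v} [CommRing k] {C : Type*} [Category C] [Preadditive C] [Linear k C]
  (M : C ⥤ ModuleCat.{w} k) [M.Additive] [M.Linear k]

/-- The linear map `a ↦ a x` sending a morphism to its effect on a fixed element `x`. -/
def mapApply {X : C} (x : M.obj X) (Y : C) : (X ⟶ Y) →ₗ[k] M.obj Y where
  toFun a := (M.map a).hom x
  map_add' a b := by rw [M.map_add, ModuleCat.hom_add, LinearMap.add_apply]
  map_smul' r a := by
    rw [M.map_smul, ModuleCat.hom_smul, LinearMap.smul_apply, RingHom.id_apply]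

/-- The action of the endomorphism algebra of `X` on the value at `X` of a linear functor. -/
def evalAlgHom (X : C) : End X →ₐ[k] Module.End k (M.obj X) :=
  AlgHom.ofLinearMap
    { toFun := fun a => (M.map a).hom
      map_add' := fun _ _ => by rw [M.map_add, ModuleCat.hom_add]
      map_smul' := fun _ _ => by rw [M.map_smul, ModuleCat.hom_smul, RingHom.id_apply] }
    (congrArg ModuleCat.Hom.hom (M.map_id X))
    (fun a b => congrArg ModuleCat.Hom.hom (M.map_comp b a))

end LinearFunctor

section CorrFunctor

variable {k : Type v} [CommRing k]

/-- The natural transformation between linear functors with components `f X`, where naturality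
is only assumed with respect to the basis elements `lin k S`. -/
def natTransOfLin (M N : CorrFunctor.{u} k) [M.Additive] [M.Linear k] [N.Additive] [N.Linear k]
    (f : ∀ X : FinCorr.{u}, M.obj (Free.of k X) →ₗ[k] N.obj (Free.of k X))
    (hf : ∀ {X Y : FinCorr.{u}} (S : X ⟶ Y) (x : M.obj (Free.of k X)),
      f Y ((M.map (lin k S)).hom x) = (N.map (lin k S)).hom (f X x)) : M ⟶ N where
  app X := ModuleCat.ofHom (f X)
  naturality {X Y} a := by
    ext x
    have hlin : f Y ∘ₗ mapApply M (X := Free.of k X) x (Free.of k Y) =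
        mapApply N (X := Free.of k X) (f X x) (Free.of k Y) :=
      lin_hom_ext fun S => hf S x
    exact LinearMap.congr_fun hlin a

variable (M : CorrFunctor.{u} k) [M.Additive] [M.Linear k] (D : FinCorr.{u})

/-- The action of the algebra of permuted orders on the value at `D` of a linear functor for
which the defining relations of this algebra act trivially. -/
def permutedOrdersAction
    (hsmall : ∀ X : FinCorr.{u}, Nat.card X < Nat.card D → Subsingleton (M.obj (Free.of k X)))
    (hrefl : ∀ S : D ⟶ D, FinCorr.Reflexive S →
      (M.map (lin k S)).hom = (M.map (lin k (FinCorr.transClosure S))).hom) :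
    PermutedOrders k D →ₐ[k] Module.End k (M.obj (Free.of k D)) :=
  RingQuot.liftAlgHom k ⟨evalAlgHom M (Free.of k D), by
    rintro _ _ (⟨_, Y, V, U, hY, rfl⟩ | ⟨S, hS⟩)
    · have := hsmall Y hY
      rw [map_zero]
      ext x
      rw [lin_comp]
      refine (map_map_apply M (lin k V) (lin k U) x).symm.trans ?_
      rw [Subsingleton.elim ((M.map (lin k V)).hom x) 0, map_zero, LinearMap.zero_apply]
    · exact hrefl S hS⟩

theorem permutedOrdersAction_toPermutedOrders
    (hsmall : ∀ X : FinCorr.{u}, Nat.card X < Nat.card D → Subsingleton (M.obj (Free.of k X)))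
    (hrefl : ∀ S : D ⟶ D, FinCorr.Reflexive S →
      (M.map (lin k S)).hom = (M.map (lin k (FinCorr.transClosure S))).hom)
    (a : End (Free.of k D)) :
    permutedOrdersAction M D hsmall hrefl (toPermutedOrders k D a) = (M.map a).hom :=
  RingQuot.liftAlgHom_mkAlgHom_apply k _ _ _

end CorrFunctor

section IndQuotient

variable {k : Type v} [CommRing k] (E : LinCorr.{u} k) (W : Type (max u v)) [AddCommGroup W]
  [Module k W] [Module (End E) W] [IsScalarTower k (End E) W]

/-- The functor `L_{E,W} / J_{E,W}`, of which the fundamental functors are special cases. -/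
abbrev indQuotient : CorrFunctor.{u} k := (indRadical E W).quotient

/-- The bilinear map sending `(φ, w)` to the class of `φ ⊗ w` in `L_{E,W} / J_{E,W}`. -/
def indQuotientMk (X : LinCorr.{u} k) : (E ⟶ X) →ₗ[k] W →ₗ[k] (indQuotient E W).obj X :=
  (indMk E W X).compr₂ ((indRadical E W).proj.app X).hom

variable {E W}

theorem map_indQuotientMk {X Y : LinCorr.{u} k} (α : X ⟶ Y) (φ : E ⟶ X) (w : W) :
    ((indQuotient E W).map α).hom (indQuotientMk E W X φ w) = indQuotientMk E W Y (φ ≫ α) w := rfl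

theorem indQuotientMk_comp {X : LinCorr.{u} k} (a : End E) (φ : E ⟶ X) (w : W) :
    indQuotientMk E W X (a ≫ φ) w = indQuotientMk E W X φ (a • w) := by
  have hbalanced : indMk E W X (a ≫ φ) w = indMk E W X φ (a • w) :=
    (Submodule.Quotient.eq _).2 (Submodule.subset_span ⟨φ, a, w, rfl⟩)
  exact congrArg ((indRadical E W).proj.app X).hom hbalanced

@[elab_as_elim]
theorem indQuotient_induction {X : LinCorr.{u} k} {p : (indQuotient E W).obj X → Prop}
    (mk : ∀ φ w, p (indQuotientMk E W X φ w)) (add : ∀ x y, p x → p y → p (x + y))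
    (x : (indQuotient E W).obj X) : p x := by
  obtain ⟨x, rfl⟩ := Submodule.mkQ_surjective _ x
  obtain ⟨t, rfl⟩ := Submodule.mkQ_surjective _ x
  induction t using TensorProduct.induction_on with
  | zero =>
    have h := mk 0 0
    rw [map_zero] at h
    exact h
  | tmul φ w => exact mk φ w
  | add t t' ht ht' => exact add _ _ ht ht'

variable (E W) in
/-- The map `L_{E,W}(E) / J_{E,W}(E) → W` sending the class of `φ ⊗ w` to `φ • w`. -/
def indQuotientCounit : (indQuotient E W).obj E →ₗ[k] W :=
  ((indRadical E W).obj E).liftQ (indEval E W E (𝟙 E)) (iInf_le _ _)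

theorem indQuotientCounit_mk (a : End E) (w : W) :
    indQuotientCounit E W (indQuotientMk E W E a w) = a • w := by
  change End.of (a ≫ 𝟙 E) • w = a • w
  rw [Category.comp_id]

theorem indQuotientMk_id_bijective : Function.Bijective (indQuotientMk E W E (𝟙 E)) := by
  constructor
  · refine Function.LeftInverse.injective (g := indQuotientCounit E W) fun w => ?_
    rw [indQuotientCounit_mk]
    exact one_smul (End E) w
  · intro x
    induction x using indQuotient_induction with
    | mk φ w => exact ⟨End.of φ • w, by rw [← indQuotientMk_comp, Category.comp_id]⟩
    | add x y hx hy =>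
      obtain ⟨a, rfl⟩ := hx
      obtain ⟨b, rfl⟩ := hy
      exact ⟨a + b, map_add _ _ _⟩

theorem indQuotientMk_id_smul (a : End E) (w : W) :
    indQuotientMk E W E (𝟙 E) (a • w) =
      ((indQuotient E W).map a).hom (indQuotientMk E W E (𝟙 E) w) := by
  rw [map_indQuotientMk, ← indQuotientMk_comp, Category.comp_id, Category.id_comp]

theorem indQuotient_ext {X : LinCorr.{u} k} {x y : (indQuotient E W).obj X}
    (h : ∀ ψ : X ⟶ E, ((indQuotient E W).map ψ).hom x = ((indQuotient E W).map ψ).hom y) :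
    x = y := by
  obtain ⟨x, rfl⟩ := Submodule.mkQ_surjective _ x
  obtain ⟨y, rfl⟩ := Submodule.mkQ_surjective _ y
  refine (Submodule.Quotient.eq _).2 ((Submodule.mem_iInf _).2 fun ψ => ?_)
  have hcounit (z : (indFunctor E W).obj X) :
      indQuotientCounit E W (((indQuotient E W).map ψ).hom (((indRadical E W).obj X).mkQ z)) =
        indEval E W X ψ z := by
    rw [← Category.comp_id ψ, ← indEval_map, Category.comp_id]
    rfl
  rw [LinearMap.mem_ker, map_sub, ← hcounit, ← hcounit, h ψ, sub_self]

theorem indQuotient_ext_lin {D X : FinCorr.{u}} {W : Type (max u v)} [AddCommGroup W]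
    [Module k W] [Module (End (Free.of k D)) W] [IsScalarTower k (End (Free.of k D)) W]
    {x y : (indQuotient (Free.of k D) W).obj (Free.of k X)}
    (h : ∀ ψ : X ⟶ D, ((indQuotient (Free.of k D) W).map (lin k ψ)).hom x =
      ((indQuotient (Free.of k D) W).map (lin k ψ)).hom y) : x = y := by
  have hlin : mapApply (indQuotient (Free.of k D) W) x (Free.of k D) =
      mapApply (indQuotient (Free.of k D) W) y (Free.of k D) := lin_hom_ext h
  exact indQuotient_ext fun ψ => LinearMap.congr_fun hlin ψ

end IndQuotient

section FundFunctor

open FinCorr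

variable (k : Type v) [CommRing k] {D : FinCorr.{u}} (Q : OrderOn D)

/-- The inclusion of the fundamental module in the algebra of permuted orders. -/
def fundVal : FundModule k Q →ₗ[k] PermutedOrders k D :=
  (Ideal.span {fundIdempotent k Q} : Ideal (PermutedOrders k D)).subtype.restrictScalars k

theorem fundVal_injective : Function.Injective (fundVal k Q) := Subtype.val_injective

theorem fundVal_smul (a : End (Free.of k D)) (w : FundModule k Q) :
    fundVal k Q (a • w) = toPermutedOrders k D a * fundVal k Q w := rfl

theorem fundVal_fundGen : fundVal k Q (fundGen k Q) = fundIdempotent k Q := rfl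

theorem exists_smul_fundGen (w : FundModule k Q) :
    ∃ a : End (Free.of k D), a • fundGen k Q = w := by
  obtain ⟨b, hb⟩ := Ideal.mem_span_singleton'.1 w.2
  obtain ⟨a, rfl⟩ := RingQuot.mkAlgHom_surjective k (PermutedOrderRel k D) b
  exact ⟨a, fundVal_injective k Q hb⟩

theorem fundUnit_bijective : Function.Bijective (fundUnit k Q) := indQuotientMk_id_bijective

theorem fundUnit_smul (a : End (Free.of k D)) (w : FundModule k Q) :
    fundUnit k Q (a • w) = ((fundFunctor k Q).map a).hom (fundUnit k Q w) :=
  indQuotientMk_id_smul a w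

/-- The class of `Δ_D ⊗ f_Q`, the canonical generator of the fundamental functor. -/
def fundElt : (fundFunctor k Q).obj (Free.of k D) := fundUnit k Q (fundGen k Q)

theorem isGenerator_fundElt : IsGenerator (fundFunctor k Q) (fundElt k Q) := by
  intro X x
  induction x using indQuotient_induction with
  | mk φ w =>
    obtain ⟨a, rfl⟩ := exists_smul_fundGen k Q w
    refine ⟨a ≫ φ, ?_⟩
    rw [← indQuotientMk_comp]
    exact congrArg (indQuotientMk _ _ X · (fundGen k Q)) (Category.id_comp (a ≫ φ))
  | add x y hx hy =>
    obtain ⟨a, rfl⟩ := hx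
    obtain ⟨b, rfl⟩ := hy
    exact ⟨a + b, map_add (mapApply (fundFunctor k Q) (fundElt k Q) X) a b⟩

variable {k Q}

theorem map_fundElt_eq_iff (a b : End (Free.of k D)) :
    ((fundFunctor k Q).map a).hom (fundElt k Q) = ((fundFunctor k Q).map b).hom (fundElt k Q) ↔
      toPermutedOrders k D a * fundIdempotent k Q =
        toPermutedOrders k D b * fundIdempotent k Q := by
  rw [fundElt, ← fundUnit_smul, ← fundUnit_smul, (fundUnit_bijective k Q).1.eq_iff,
    ← (fundVal_injective k Q).eq_iff, fundVal_smul, fundVal_smul, fundVal_fundGen]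

theorem map_fundElt_eq_zero_iff (a : End (Free.of k D)) :
    ((fundFunctor k Q).map a).hom (fundElt k Q) = 0 ↔
      toPermutedOrders k D a * fundIdempotent k Q = 0 := by
  simpa [Functor.map_zero] using map_fundElt_eq_iff (Q := Q) a 0

theorem map_lin_fundElt_congr {X : FinCorr.{u}} {φ φ' : D ⟶ X}
    (h : ∀ (ψ : X ⟶ D) (τ : Equiv.Perm D), Fits Q (φ ≫ ψ) τ ↔ Fits Q (φ' ≫ ψ) τ) :
    ((fundFunctor k Q).map (lin k φ)).hom (fundElt k Q) =
      ((fundFunctor k Q).map (lin k φ')).hom (fundElt k Q) := by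
  refine indQuotient_ext_lin fun ψ => ?_
  rw [map_map_apply, map_map_apply, ← lin_comp, ← lin_comp]
  exact (map_fundElt_eq_iff _ _).2 (relClass_mul_fundIdempotent_congr k (h ψ))

theorem map_lin_fundElt_eq_zero {X : FinCorr.{u}} {φ : D ⟶ X}
    (h : ∀ (ψ : X ⟶ D) (τ : Equiv.Perm D), ¬ Fits Q (φ ≫ ψ) τ) :
    ((fundFunctor k Q).map (lin k φ)).hom (fundElt k Q) = 0 := by
  refine indQuotient_ext_lin fun ψ => ?_
  rw [map_map_apply, ← lin_comp, map_zero]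
  refine (map_fundElt_eq_zero_iff _).2 (by_contra fun hne => ?_)
  obtain ⟨τ, hτ⟩ := exists_fits_of_mul_ne_zero hne
  exact h ψ τ hτ

theorem subsingleton_fundFunctor_obj {X : FinCorr.{u}} (hX : Nat.card X < Nat.card D) :
    Subsingleton ((fundFunctor k Q).obj (Free.of k X)) := by
  refine subsingleton_of_forall_eq 0 fun x => indQuotient_ext fun ψ => ?_
  obtain ⟨a, rfl⟩ := isGenerator_fundElt k Q _ x
  rw [map_zero, map_map_apply]
  refine (map_fundElt_eq_zero_iff _).2 ?_
  rw [toPermutedOrders_comp_eq_zero k hX, zero_mul]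

end FundFunctor

section CorrAct

variable {T : Type u} [Lattice T] [BoundedOrder T] {X Y : FinCorr.{u}} {S : X ⟶ Y}

theorem le_corrAct {x : X} {y : Y} (h : (y, x) ∈ S.rel) (φ : X → T) : φ x ≤ corrAct S φ y :=
  Finset.le_sup (f := φ) ((Set.Finite.mem_toFinset _).2 h)

theorem corrAct_le {φ : X → T} {y : Y} {t : T} (h : ∀ x, (y, x) ∈ S.rel → φ x ≤ t) :
    corrAct S φ y ≤ t :=
  Finset.sup_le fun x hx => h x ((Set.Finite.mem_toFinset (s := {x | (y, x) ∈ S.rel}) _).1 hx)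

theorem exists_of_corrAct_eq {φ : X → T} {y : Y} {t : T} (ht : SupIrred t)
    (h : corrAct S φ y = t) : ∃ x, (y, x) ∈ S.rel ∧ φ x = t := by
  obtain ⟨x, hx, h⟩ := ht.finset_sup_eq h
  exact ⟨x, (Set.Finite.mem_toFinset (s := {x | (y, x) ∈ S.rel}) _).1 hx, h⟩

end CorrAct

/-- The image of `φ` contains all irreducible elements of `T`. The maps which are not full span
the subfunctor `H_T` of `F_T`. -/
def IsFull {X T : Type*} [SemilatticeSup T] (φ : X → T) : Prop :=
  {e : T | SupIrred e} ⊆ Set.range φ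

/-- The map `j` identifies `D` with the set of irreducible elements of `T`, and `Q` with the
opposite of the order of `T`. Allowing an arbitrary `D` makes it possible to transport the
irreducible elements to any set of the same cardinality. -/
structure IsIrrParam {D T : Type u} [SemilatticeSup T] (Q : OrderOn D) (j : D → T) : Prop where
  range_eq : Set.range j = {t | SupIrred t}
  mem_iff : ∀ a b, (a, b) ∈ Q.rel ↔ j b ≤ j a

namespace IsIrrParam

section Order

variable {D X T : Type u} [SemilatticeSup T] {Q : OrderOn D} {j : D → T}

theorem injective (hj : IsIrrParam Q j) : Function.Injective j := fun a b h =>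
  Q.antisymm a b ((hj.mem_iff a b).2 h.ge) ((hj.mem_iff b a).2 h.le)

theorem supIrred (hj : IsIrrParam Q j) (d : D) : SupIrred (j d) := hj.range_eq.le ⟨d, rfl⟩

theorem isFull (hj : IsIrrParam Q j) : IsFull j := hj.range_eq.ge

theorem comp_equiv (hj : IsIrrParam Q j) (e : X ≃ D) :
    IsIrrParam (Q.comap e.toEmbedding) (j ∘ e) :=
  ⟨(e.surjective.range_comp j).trans hj.range_eq, fun a b => hj.mem_iff (e a) (e b)⟩

theorem exists_comp_eq (hj : IsIrrParam Q j) {φ : X → T} (hφ : IsFull φ) :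
    ∃ g : D → X, φ ∘ g = j := by
  choose g hg using fun d => hφ (hj.supIrred d)
  exact ⟨g, funext hg⟩

theorem card_le (hj : IsIrrParam Q j) [Finite X] {φ : X → T} (hφ : IsFull φ) :
    Nat.card D ≤ Nat.card X := by
  obtain ⟨g, rfl⟩ := hj.exists_comp_eq hφ
  exact Nat.card_le_card_of_injective g hj.injective.of_comp

theorem exists_perm_eq_comp [Finite D] (hj : IsIrrParam Q j) {φ : D → T} (hφ : IsFull φ) :
    ∃ σ : Equiv.Perm D, φ = j ∘ σ := by
  obtain ⟨g, rfl⟩ := hj.exists_comp_eq hφ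
  refine ⟨(Equiv.ofBijective g (Finite.injective_iff_bijective.1 hj.injective.of_comp)).symm, ?_⟩
  exact (Equiv.eq_comp_symm _ φ (φ ∘ g)).2 rfl

theorem le_of_forall_le [OrderBot T] [WellFoundedLT T] (hj : IsIrrParam Q j) {s t : T}
    (h : ∀ d, j d ≤ s → j d ≤ t) : s ≤ t := by
  obtain ⟨A, rfl, hA⟩ := exists_supIrred_decomposition s
  refine Finset.sup_le fun a ha => ?_
  obtain ⟨d, rfl⟩ := hj.isFull (hA ha)
  exact h d (Finset.le_sup (f := id) ha)

end Order

theorem corrAct_eq_self {T : Type u} [Lattice T] [BoundedOrder T] {D : FinCorr.{u}}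
    {Q : OrderOn D} {j : D → T} (hj : IsIrrParam Q j) {S : D ⟶ D} (hS : FinCorr.Reflexive S)
    {φ : D → T} (hφ : IsFull φ) (hSφ : IsFull (corrAct S φ)) : corrAct S φ = φ := by
  obtain ⟨σ, hσ⟩ := hj.exists_perm_eq_comp hφ
  obtain ⟨τ, hτ⟩ := hj.exists_perm_eq_comp hSφ
  refine (eq_of_le_of_injective_of_range_subset (fun d => le_corrAct (hS d) φ) ?_ ?_).symm
  · rw [hτ]
    exact hj.injective.comp τ.injective
  · rw [hτ, hσ, σ.surjective.range_comp, τ.surjective.range_comp]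

end IsIrrParam

section FullQuotient

open FinCorr

variable (k : Type v) [CommRing k] {T : Type u} [Lattice T] [BoundedOrder T]

variable (T) in
/-- The functor `F_T / H_T`. -/
abbrev fullQuotient : CorrFunctor.{u} k := (nonFull k T).quotient

/-- A map `φ : X → T`, as a basis element of `F_T(X)`. -/
def latticeMk {X : FinCorr.{u}} (φ : X → T) : (latticeFunctor k T).obj (Free.of k X) :=
  Finsupp.single φ (1 : k)

/-- The class in `F_T / H_T` of a map `φ : X → T`. -/
def fullMk {X : FinCorr.{u}} (φ : X → T) : (fullQuotient k T).obj (Free.of k X) :=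
  ((nonFull k T).proj.app (Free.of k X)).hom (latticeMk k φ)

variable {k} in
theorem latticeFunctor_hom_ext {X : FinCorr.{u}} {W : Type w} [AddCommGroup W] [Module k W]
    {f g : (latticeFunctor k T).obj (Free.of k X) →ₗ[k] W}
    (h : ∀ φ : X → T, f (latticeMk k φ) = g (latticeMk k φ)) : f = g :=
  Finsupp.lhom_ext' fun φ => LinearMap.ext_ring (h φ)

theorem map_latticeMk {X Y : FinCorr.{u}} (S : X ⟶ Y) (φ : X → T) :
    ((latticeFunctor k T).map (lin k S)).hom (latticeMk k φ) = latticeMk k (corrAct S φ) := by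
  change latticeMap k T X Y (lin k S) (Finsupp.single φ 1) = _
  rw [latticeMap_lin, Finsupp.lmapDomain_apply, Finsupp.mapDomain_single]
  rfl

theorem map_fullMk {X Y : FinCorr.{u}} (S : X ⟶ Y) (φ : X → T) :
    ((fullQuotient k T).map (lin k S)).hom (fullMk k φ) = fullMk k (corrAct S φ) := by
  refine (app_map_apply (nonFull k T).proj (lin k S) (latticeMk k φ)).symm.trans ?_
  rw [map_latticeMk]
  rfl

theorem fullMk_eq_zero {X : FinCorr.{u}} {φ : X → T} (h : ¬ IsFull φ) : fullMk k φ = 0 :=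
  (Submodule.Quotient.mk_eq_zero (nonFullSubmodule k T X)).2 (Submodule.subset_span ⟨φ, h, rfl⟩)

theorem fullMk_ne_zero [Nontrivial k] {X : FinCorr.{u}} {φ : X → T} (h : IsFull φ) :
    fullMk k φ ≠ 0 := by
  intro hzero
  have hle : nonFullSubmodule k T X ≤ LinearMap.ker (Finsupp.lapply φ) := by
    refine Submodule.span_le.2 ?_
    rintro _ ⟨φ', hφ', rfl⟩
    have hne : φ' ≠ φ := fun heq => hφ' (heq ▸ h)
    exact Finsupp.single_eq_of_ne' hne
  have hcoeff := hle ((Submodule.Quotient.mk_eq_zero (nonFullSubmodule k T X)).1 hzero)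
  exact one_ne_zero ((Finsupp.single_eq_same (a := φ) (b := (1 : k))).symm.trans hcoeff)

variable {k} in
theorem fullQuotient_hom_ext {X : FinCorr.{u}} {W : Type w} [AddCommGroup W] [Module k W]
    {f g : (fullQuotient k T).obj (Free.of k X) →ₗ[k] W}
    (h : ∀ φ : X → T, f (fullMk k φ) = g (fullMk k φ)) : f = g :=
  Submodule.linearMap_qext _ (latticeFunctor_hom_ext h)

namespace IsIrrParam

variable {D : FinCorr.{u}} {Q : OrderOn D} {j : D → T}

theorem subsingleton_fullQuotient_obj (hj : IsIrrParam Q j) {X : FinCorr.{u}}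
    (hX : Nat.card X < Nat.card D) : Subsingleton ((fullQuotient k T).obj (Free.of k X)) := by
  have hid : (LinearMap.id : _ →ₗ[k] (fullQuotient k T).obj (Free.of k X)) = 0 :=
    fullQuotient_hom_ext fun φ => fullMk_eq_zero k fun hφ => hX.not_ge (hj.card_le hφ)
  exact subsingleton_of_forall_eq 0 (LinearMap.congr_fun hid)

open Classical in
theorem map_fullMk_of_reflexive (hj : IsIrrParam Q j) {S : D ⟶ D} (hS : Reflexive S)
    {φ : D → T} (hφ : IsFull φ) :
    ((fullQuotient k T).map (lin k S)).hom (fullMk k φ) =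
      if S.rel ⊆ {p | φ p.2 ≤ φ p.1} then fullMk k φ else 0 := by
  rw [map_fullMk]
  split_ifs with h
  · congr 1
    exact funext fun d => le_antisymm (corrAct_le fun x hx => h hx) (le_corrAct (hS d) φ)
  · refine fullMk_eq_zero k fun hSφ => h fun p hp => ?_
    exact (le_corrAct hp φ).trans_eq (congrFun (hj.corrAct_eq_self hS hφ hSφ) p.1)

theorem map_lin_transClosure (hj : IsIrrParam Q j) {S : D ⟶ D} (hS : Reflexive S) :
    ((fullQuotient k T).map (lin k S)).hom =
      ((fullQuotient k T).map (lin k (transClosure S))).hom := by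
  classical
  refine fullQuotient_hom_ext fun φ => ?_
  by_cases hφ : IsFull φ
  · rw [hj.map_fullMk_of_reflexive k hS hφ, hj.map_fullMk_of_reflexive k hS.transClosure hφ]
    exact if_congr (transClosure_subset_iff (P := {p | φ p.2 ≤ φ p.1})
      fun _ _ _ h h' => le_trans h' h).symm rfl rfl
  · rw [fullMk_eq_zero k hφ, map_zero, map_zero]

/-- The action of the algebra of permuted orders on the value of `F_T / H_T` at the set of
irreducible elements of `T`. -/
def action (hj : IsIrrParam Q j) :
    PermutedOrders k D →ₐ[k] Module.End k ((fullQuotient k T).obj (Free.of k D)) :=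
  permutedOrdersAction (fullQuotient k T) D (fun _ => hj.subsingleton_fullQuotient_obj k)
    fun _ => hj.map_lin_transClosure k

theorem action_toPermutedOrders (hj : IsIrrParam Q j) (a : End (Free.of k D)) :
    hj.action k (toPermutedOrders k D a) = ((fullQuotient k T).map a).hom :=
  permutedOrdersAction_toPermutedOrders _ _ _ _ a

theorem action_fundIdempotent (hj : IsIrrParam Q j) :
    hj.action k (fundIdempotent k Q) (fullMk k j) = fullMk k j := by
  classical
  have hle (S : OrderOn D) : S.rel ⊆ {p | j p.2 ≤ j p.1} ↔ S ≤ Q :=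
    forall₂_congr fun p _ => (hj.mem_iff p.1 p.2).symm
  have hact (S : OrderOn D) : hj.action k (toPermutedOrders k D (lin k (ofOrder S)))
      (fullMk k j) = if S ≤ Q then fullMk k j else 0 := by
    rw [action_toPermutedOrders, hj.map_fullMk_of_reflexive k (S := ofOrder S) S.refl hj.isFull]
    exact if_congr (hle S) rfl rfl
  simp only [fundIdempotent, map_sum, map_smul, LinearMap.sum_apply, LinearMap.smul_apply, hact,
    sum_mu_smul_ite_le, if_true]

theorem fundIdempotent_ne_zero [Nontrivial k] (hj : IsIrrParam Q j) :
    fundIdempotent k Q ≠ 0 := by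
  intro h
  have hzero := hj.action_fundIdempotent k
  rw [h, map_zero, LinearMap.zero_apply] at hzero
  exact fullMk_ne_zero k hj.isFull hzero.symm

end IsIrrParam

/-- Every finite poset is the poset of irreducible elements of a finite lattice, here the lattice
of lower sets for the opposite order. -/
theorem fundIdempotent_ne_zero [Nontrivial k] {D : FinCorr.{u}} (Q : OrderOn D) :
    fundIdempotent k Q ≠ 0 := by
  let _ : PartialOrder D :=
    { le := fun a b => (b, a) ∈ Q.rel
      le_refl := Q.refl
      le_trans := fun _ _ _ h h' => Q.trans _ _ _ h' h
      le_antisymm := fun _ _ h h' => Q.antisymm _ _ h' h }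
  have hj : IsIrrParam Q (LowerSet.Iic : D → LowerSet D) :=
    ⟨Set.ext fun _ => LowerSet.supIrred_iff_of_finite.symm,
      fun a b => (LowerSet.Iic_le (s := LowerSet.Iic a) (a := b)).symm⟩
  exact hj.fundIdempotent_ne_zero k

end FullQuotient

theorem SubCorrFunctor.isGenerator_proj {k : Type v} [CommRing k] {M : CorrFunctor.{u} k}
    (N : SubCorrFunctor M) {X : LinCorr.{u} k} {x : M.obj X} (hx : IsGenerator M x) :
    IsGenerator N.quotient ((N.proj.app X).hom x) :=
  hx.app_of_surjective fun Y => (N.obj Y).mkQ_surjective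

/-- The morphism induced on the quotient by a subfunctor on which `f` vanishes. -/
def SubCorrFunctor.desc {k : Type v} [CommRing k] {M M' : CorrFunctor.{u} k}
    (N : SubCorrFunctor M) (f : M ⟶ M') (hf : ∀ X, N.obj X ≤ LinearMap.ker (f.app X).hom) :
    N.quotient ⟶ M' where
  app X := ModuleCat.ofHom ((N.obj X).liftQ (f.app X).hom (hf X))
  naturality _ _ a := ModuleCat.hom_ext <| Submodule.linearMap_qext _ <|
    congrArg ModuleCat.Hom.hom (f.naturality a)

/-- The relation consisting of all `(x, d)` such that `j d ≤ φ x`. -/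
def cone {X D : FinCorr.{u}} {T : Type*} [LE T] (j : D → T) (φ : X → T) : D ⟶ X :=
  ⟨{p | j p.2 ≤ φ p.1}⟩

namespace IsIrrParam

open FinCorr

section Cone

variable {T : Type u} [SemilatticeSup T] {D X : FinCorr.{u}} {Q : OrderOn D} {j : D → T}
  {φ : X → T}

theorem cone_self (hj : IsIrrParam Q j) : cone j j = ofOrder Q :=
  hom_ext fun a b => (hj.mem_iff a b).symm

variable [OrderBot T] [WellFoundedLT T]

theorem le_of_fits_cone (hj : IsIrrParam Q j) {ψ : X ⟶ D} {τ : Equiv.Perm D}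
    (h : Fits Q (cone j φ ≫ ψ) τ) {d : D} {x : X} (hx : (τ d, x) ∈ ψ.rel) : φ x ≤ j d :=
  hj.le_of_forall_le fun b hb => (hj.mem_iff d b).1 (h.mem_order d b ⟨x, hx, hb⟩)

theorem isFull_of_fits_cone (hj : IsIrrParam Q j) {ψ : X ⟶ D} {τ : Equiv.Perm D}
    (h : Fits Q (cone j φ ≫ ψ) τ) : IsFull φ := by
  intro e he
  obtain ⟨d, rfl⟩ := hj.range_eq.ge he
  obtain ⟨x, hx, hd⟩ := h.graph_mem d
  exact ⟨x, le_antisymm (hj.le_of_fits_cone h hx) hd⟩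

end Cone

section ConeAction

variable {T : Type u} [Lattice T] [BoundedOrder T] [Finite T] {D X Y : FinCorr.{u}}
  {Q : OrderOn D} {j : D → T}

theorem corrAct_cone (hj : IsIrrParam Q j) (φ : X → T) : corrAct (cone j φ) j = φ :=
  funext fun _ => le_antisymm (corrAct_le fun _ hd => hd)
    (hj.le_of_forall_le fun _ hd => le_corrAct (S := cone j φ) hd j)

theorem fits_cone_corrAct_iff (hj : IsIrrParam Q j) (S : X ⟶ Y) (φ : X → T) (ψ : Y ⟶ D)
    (τ : Equiv.Perm D) :
    Fits Q (cone j (corrAct S φ) ≫ ψ) τ ↔ Fits Q ((cone j φ ≫ S) ≫ ψ) τ := by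
  have hle : ((cone j φ ≫ S) ≫ ψ).rel ⊆ (cone j (corrAct S φ) ≫ ψ).rel :=
    fun _ ⟨y, hy, x, hx, hd⟩ => ⟨y, hy, le_trans hd (le_corrAct hx φ)⟩
  constructor
  · refine fun h => ⟨fun d => ?_, fun a b hab => h.mem_order a b (hle hab)⟩
    obtain ⟨y, hy, hd⟩ := h.graph_mem d
    obtain ⟨x, hx, hxd⟩ := exists_of_corrAct_eq (hj.supIrred d)
      (le_antisymm (hj.le_of_fits_cone h hy) hd)
    exact ⟨y, hy, x, hx, hxd.ge⟩
  · refine fun h => ⟨fun d => hle (h.graph_mem d), fun a b ⟨y, hy, hb⟩ => ?_⟩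
    refine (hj.mem_iff a b).2 (le_trans hb (corrAct_le fun x hx => ?_))
    exact hj.le_of_forall_le fun d hd => (hj.mem_iff a d).1 (h.mem_order a d ⟨y, hy, x, hx, hd⟩)

end ConeAction

variable (k : Type v) [CommRing k] {T : Type u} [Lattice T] [BoundedOrder T]
  {D : FinCorr.{u}} {Q : OrderOn D} {j : D → T}

variable (Q j) in
/-- The `X`-component of the morphism `F_T ⟶ 𝕊_{D,Q}` sending `φ` to the class of
`cone j φ ⊗ f_Q`. -/
def toFundMap (X : FinCorr.{u}) :
    (latticeFunctor k T).obj (Free.of k X) →ₗ[k] (fundFunctor k Q).obj (Free.of k X) :=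
  Finsupp.linearCombination k fun φ : X → T =>
    ((fundFunctor k Q).map (lin k (cone j φ))).hom (fundElt k Q)

theorem toFundMap_latticeMk {X : FinCorr.{u}} (φ : X → T) :
    toFundMap k Q j X (latticeMk k φ) =
      ((fundFunctor k Q).map (lin k (cone j φ))).hom (fundElt k Q) := by
  refine (Finsupp.linearCombination_single k (1 : k) φ).trans ?_
  rw [one_smul]

variable [Finite T]

theorem isGenerator_latticeMk (hj : IsIrrParam Q j) :
    IsGenerator (latticeFunctor k T) (latticeMk k j) := by
  intro X x
  induction x using Finsupp.induction_linear with
  | zero => exact ⟨0, map_zero (mapApply (latticeFunctor k T) (latticeMk k j) X)⟩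
  | add x y hx hy =>
    obtain ⟨a, rfl⟩ := hx
    obtain ⟨b, rfl⟩ := hy
    exact ⟨a + b, map_add (mapApply (latticeFunctor k T) (latticeMk k j) X) a b⟩
  | single φ r =>
    refine ⟨r • lin k (cone (X := X) j φ), ?_⟩
    refine (map_smul (mapApply (latticeFunctor k T) (latticeMk k j) X) r _).trans ?_
    refine (congrArg (r • ·) (map_latticeMk k (cone (X := X) j φ) j)).trans ?_
    refine (congrArg (r • latticeMk k ·) (hj.corrAct_cone (X := X) φ)).trans ?_
    exact Finsupp.smul_single_one φ r

theorem isGenerator_fullMk (hj : IsIrrParam Q j) : IsGenerator (fullQuotient k T) (fullMk k j) :=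
  (nonFull k T).isGenerator_proj (hj.isGenerator_latticeMk k)

theorem toFundMap_map (hj : IsIrrParam Q j) {X Y : FinCorr.{u}} (S : X ⟶ Y)
    (x : (latticeFunctor k T).obj (Free.of k X)) :
    toFundMap k Q j Y (((latticeFunctor k T).map (lin k S)).hom x) =
      ((fundFunctor k Q).map (lin k S)).hom (toFundMap k Q j X x) := by
  suffices h : toFundMap k Q j Y ∘ₗ ((latticeFunctor k T).map (lin k S)).hom =
      ((fundFunctor k Q).map (lin k S)).hom ∘ₗ toFundMap k Q j X from LinearMap.congr_fun h x
  refine latticeFunctor_hom_ext fun φ => ?_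
  rw [LinearMap.comp_apply, LinearMap.comp_apply, map_latticeMk, toFundMap_latticeMk,
    toFundMap_latticeMk, map_map_apply, ← lin_comp]
  exact map_lin_fundElt_congr fun ψ τ => hj.fits_cone_corrAct_iff S φ ψ τ

/-- The morphism `F_T ⟶ 𝕊_{D,Q}` with components `toFundMap`. -/
def toFund (hj : IsIrrParam Q j) : latticeFunctor k T ⟶ fundFunctor k Q :=
  natTransOfLin (latticeFunctor k T) (fundFunctor k Q) (toFundMap k Q j) (hj.toFundMap_map k)

theorem toFund_latticeMk (hj : IsIrrParam Q j) {X : FinCorr.{u}} (φ : X → T) :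
    ((hj.toFund k).app (Free.of k X)).hom (latticeMk k φ) =
      ((fundFunctor k Q).map (lin k (cone j φ))).hom (fundElt k Q) :=
  toFundMap_latticeMk k φ

theorem toFund_self (hj : IsIrrParam Q j) :
    ((hj.toFund k).app (Free.of k D)).hom (latticeMk k j) = fundElt k Q := by
  classical
  rw [toFund_latticeMk, hj.cone_self, fundElt, ← fundUnit_smul]
  refine congrArg _ (fundVal_injective k Q ?_)
  exact (relClass_mul_fundIdempotent k (V := ofOrder Q) Q.refl Q).trans (if_pos subset_rfl)

/-- The morphism `F_T / H_T ⟶ 𝕊_{D,Q}` induced by `toFund`. -/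
def toFundBar (hj : IsIrrParam Q j) : fullQuotient k T ⟶ fundFunctor k Q :=
  (nonFull k T).desc (hj.toFund k) fun X => Submodule.span_le.2 <| by
    rintro _ ⟨φ, hφ, rfl⟩
    exact (hj.toFund_latticeMk k φ).trans
      (map_lin_fundElt_eq_zero fun ψ τ h => hφ (hj.isFull_of_fits_cone h))

theorem toFundBar_self (hj : IsIrrParam Q j) :
    ((hj.toFundBar k).app (Free.of k D)).hom (fullMk k j) = fundElt k Q :=
  hj.toFund_self k

theorem toFundBar_bijective (hj : IsIrrParam Q j) :
    Function.Bijective ((hj.toFundBar k).app (Free.of k D)).hom := by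
  have hmap (a : End (Free.of k D)) :
      ((hj.toFundBar k).app (Free.of k D)).hom (((fullQuotient k T).map a).hom (fullMk k j)) =
        ((fundFunctor k Q).map a).hom (fundElt k Q) := by
    rw [app_map_apply, toFundBar_self]
  constructor
  · refine (injective_iff_map_eq_zero _).2 fun x hx => ?_
    obtain ⟨a, rfl⟩ := hj.isGenerator_fullMk k _ x
    have hzero : toPermutedOrders k D a * fundIdempotent k Q = 0 :=
      (map_fundElt_eq_zero_iff a).1 ((hmap a).symm.trans hx)
    calc ((fullQuotient k T).map a).hom (fullMk k j)
        = hj.action k (toPermutedOrders k D a * fundIdempotent k Q) (fullMk k j) := by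
          rw [map_mul, Module.End.mul_apply, action_fundIdempotent, action_toPermutedOrders]
      _ = 0 := by rw [hzero, map_zero, LinearMap.zero_apply]
  · intro y
    obtain ⟨a, rfl⟩ := isGenerator_fundElt k Q _ y
    exact ⟨_, hmap a⟩

end IsIrrParam

section Nonzero

variable {k : Type v} [CommRing k] {D E : FinCorr.{u}} {Q : OrderOn D}

theorem fundElt_ne_zero [Nontrivial k] : fundElt k Q ≠ 0 := by
  intro h
  have hzero := (map_fundElt_eq_zero_iff (Q := Q) (𝟙 (Free.of k D))).1 (by rw [h, map_zero])
  have hone : toPermutedOrders k D (𝟙 (Free.of k D)) = 1 := map_one _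
  rw [hone, one_mul] at hzero
  exact fundIdempotent_ne_zero k Q hzero

theorem hom_fundFunctor_ne_zero_of_surjective [Nontrivial k] {M : CorrFunctor.{u} k}
    {Φ : M ⟶ fundFunctor k Q} (hΦ : Function.Surjective (Φ.app (Free.of k D)).hom) : Φ ≠ 0 := by
  rintro rfl
  obtain ⟨x, hx⟩ := hΦ (fundElt k Q)
  exact fundElt_ne_zero hx.symm

variable {T : Type u} [Lattice T] [BoundedOrder T] [Finite T]
  {Φ : fullQuotient k T ⟶ fundFunctor k Q}

namespace IsIrrParam

theorem card_eq_of_ne_zero {R : OrderOn E} {j : E → T} (hj : IsIrrParam R j) (hΦ : Φ ≠ 0) :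
    Nat.card D = Nat.card E := by
  have hne := (hj.isGenerator_fullMk k).app_ne_zero hΦ
  apply le_antisymm
  · by_contra! hlt
    have := subsingleton_fundFunctor_obj (k := k) (Q := Q) hlt
    exact hne (Subsingleton.elim _ _)
  · by_contra! hlt
    have := hj.subsingleton_fullQuotient_obj k hlt
    refine hne (indQuotient_ext fun ψ => ?_)
    rw [← app_map_apply, Subsingleton.elim (((fullQuotient k T).map ψ).hom _) 0, map_zero,
      map_zero]

theorem exists_eq_comap_of_ne_zero {R : OrderOn D} {j : D → T} (hj : IsIrrParam R j)
    (hΦ : Φ ≠ 0) : ∃ τ : Equiv.Perm D, R = Q.comap τ.toEmbedding := by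
  obtain ⟨a, ha⟩ := isGenerator_fundElt k Q _ ((Φ.app (Free.of k D)).hom (fullMk k j))
  replace ha : ((fundFunctor k Q).map a).hom (fundElt k Q) =
    (Φ.app (Free.of k D)).hom (fullMk k j) := ha
  obtain ⟨r, hr⟩ : ∃ r, toPermutedOrders k D r = fundIdempotent k R :=
    RingQuot.mkAlgHom_surjective k (PermutedOrderRel k D) _
  have hfix : ((fullQuotient k T).map r).hom (fullMk k j) = fullMk k j := by
    rw [← hj.action_toPermutedOrders k, hr, hj.action_fundIdempotent k]
  have hmap : ((fundFunctor k Q).map (a ≫ r)).hom (fundElt k Q) ≠ 0 := by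
    rw [← map_map_apply, ha, ← app_map_apply, hfix]
    exact (hj.isGenerator_fullMk k).app_ne_zero hΦ
  refine exists_eq_comap_of_mul_ne_zero (b := toPermutedOrders k D a) fun h => hmap ?_
  rw [map_fundElt_eq_zero_iff, ← End.mul_def, map_mul, hr, mul_assoc, h]

theorem exists_equiv_of_ne_zero {R : OrderOn E} {j : E → T} (hj : IsIrrParam R j)
    (hΦ : Φ ≠ 0) : ∃ e : D ≃ E, ∀ a b, (a, b) ∈ Q.rel ↔ (e a, e b) ∈ R.rel := by
  obtain ⟨e⟩ := Finite.card_eq.1 (hj.card_eq_of_ne_zero hΦ)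
  obtain ⟨τ, hτ⟩ := (hj.comp_equiv e).exists_eq_comap_of_ne_zero hΦ
  refine ⟨τ.symm.trans e, fun a b => ?_⟩
  change _ ↔ (τ.symm a, τ.symm b) ∈ (R.comap e.toEmbedding).rel
  rw [hτ]
  change _ ↔ (τ (τ.symm a), τ (τ.symm b)) ∈ Q.rel
  rw [τ.apply_symm_apply, τ.apply_symm_apply]

end IsIrrParam

end Nonzero

theorem isIrrParam_irr (T : Type u) [Lattice T] [Finite T] :
    IsIrrParam (irrOrder T).op (Subtype.val : {e : T // SupIrred e} → T) :=
  ⟨Subtype.range_coe, fun _ _ => Iff.rfl⟩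

end

theorem mainTheorem4_general (k : Type v) [CommRing k]
    (T : Type u) [Lattice T] [BoundedOrder T] [Finite T]
    (D : FinCorr.{u}) (Q : OrderOn D)
    (Φ : (nonFull k T).quotient ⟶ fundFunctor k Q) (hΦ : Φ ≠ 0) :
    Nat.card D = Nat.card (irr T) ∧
    (∃ e : D ≃ irr T, ∀ a b : D, (a, b) ∈ Q.rel ↔ (e a, e b) ∈ (irrOrder T).op.rel) ∧
    ∃ Θ : latticeFunctor k T ⟶ fundFunctor k (irrOrder T).op,
      (Θ.app (Free.of k (irr T))).hom (irrIncl k T) =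
          fundUnit k (irrOrder T).op (fundGen k (irrOrder T).op) ∧
      (∀ Θ' : latticeFunctor k T ⟶ fundFunctor k (irrOrder T).op,
        (Θ'.app (Free.of k (irr T))).hom (irrIncl k T) =
          fundUnit k (irrOrder T).op (fundGen k (irrOrder T).op) → Θ' = Θ) ∧
      ∃ Θbar : (nonFull k T).quotient ⟶ fundFunctor k (irrOrder T).op,
        (nonFull k T).proj ≫ Θbar = Θ ∧
        (SubCorrFunctor.ker Θbar).obj (Free.of k (irr T)) = ⊥ ∧
        Function.Bijective (Θbar.app (Free.of k (irr T))).hom ∧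
        Function.Bijective (fundUnit k (irrOrder T).op) ∧
        ∀ (a : End (Free.of k (irr T))) (w : FundModule k (irrOrder T).op),
          fundUnit k (irrOrder T).op (a • w) =
            ((fundFunctor k (irrOrder T).op).map a).hom (fundUnit k (irrOrder T).op w) := by
  have hj := isIrrParam_irr T
  have hbar := hj.toFundBar_bijective k
  exact ⟨hj.card_eq_of_ne_zero hΦ, hj.exists_equiv_of_ne_zero hΦ, hj.toFund k, hj.toFund_self k,
    fun Θ' h => (hj.isGenerator_latticeMk k).hom_ext (h.trans (hj.toFund_self k).symm),
    hj.toFundBar k, rfl, LinearMap.ker_eq_bot.2 hbar.1, hbar, fundUnit_bijective k _,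
    fundUnit_smul k _⟩

theorem mainTheorem4 (k : Type v) [CommRing k] [Nontrivial k]
    (T : Type u) [Lattice T] [BoundedOrder T] [Finite T]
    (D : FinCorr.{u}) (Q : OrderOn D)
    (Φ : (nonFull k T).quotient ⟶ fundFunctor k Q)
    (hΦ : ∀ X, Function.Surjective (Φ.app X).hom) :
    Nat.card D = Nat.card (irr T) ∧
    (∃ e : D ≃ irr T, ∀ a b : D, (a, b) ∈ Q.rel ↔ (e a, e b) ∈ (irrOrder T).op.rel) ∧
    ∃ Θ : latticeFunctor k T ⟶ fundFunctor k (irrOrder T).op,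
      (Θ.app (Free.of k (irr T))).hom (irrIncl k T) =
          fundUnit k (irrOrder T).op (fundGen k (irrOrder T).op) ∧
      (∀ Θ' : latticeFunctor k T ⟶ fundFunctor k (irrOrder T).op,
        (Θ'.app (Free.of k (irr T))).hom (irrIncl k T) =
          fundUnit k (irrOrder T).op (fundGen k (irrOrder T).op) → Θ' = Θ) ∧
      ∃ Θbar : (nonFull k T).quotient ⟶ fundFunctor k (irrOrder T).op,
        (nonFull k T).proj ≫ Θbar = Θ ∧
        (SubCorrFunctor.ker Θbar).obj (Free.of k (irr T)) = ⊥ ∧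
        Function.Bijective (Θbar.app (Free.of k (irr T))).hom ∧
        Function.Bijective (fundUnit k (irrOrder T).op) ∧
        ∀ (a : End (Free.of k (irr T))) (w : FundModule k (irrOrder T).op),
          fundUnit k (irrOrder T).op (a • w) =
            ((fundFunctor k (irrOrder T).op).map a).hom (fundUnit k (irrOrder T).op w) :=
  mainTheorem4_general k T D Q Φ (hom_fundFunctor_ne_zero_of_surjective (hΦ (Free.of k D)))
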